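/- There is a family of CNF formulas $(F_n)_{n\in\mathbb N}$, where $F_n$ is over $n$ Boolean variables and has $n^{O(1)}$ clauses, such that 1. every $F_n$ has a (dag-like) resolution refutation consisting of $n^{O(1)}$ clauses; 2. every Odd Hitting refutation of $F_n$ has at least $2^{\Omega(n/\log n)}$ clauses; that is, there are constants $c>0$ and $N$ such that for every $n\ge N$ every Odd Hitting refutation of $F_n$ has at least $2^{c\,n/\log n}$ clauses. Here clauses are finite sets of literals, and the only rule of resolution is to derive $C\lor D$ from $C\lor x$ and $D\lor\overline{x}$. An *odd hitting formula* is a CNF formula $H=C_1\land\dots\land C_m$ (repeated clauses are allowed) such that every assignment falsifying $H$ falsifies an odd number of the clauses $C_1,\dots,C_m$. An *Odd Hitting refutation* of a CNF formula $F$ is an unsatisfiable odd hitting formula $H$, over the same variables, such that every clause $C$ of $H$ contains some clause $C'\subseteq C$ of $F$. -/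

import Mathlib

namespace OddHit

/-- A literal over the variables `V`: `(x, true)` is `x` and `(x, false)` is its negation. -/
abbrev Literal (V : Type) : Type := V × Bool

/-- A clause is a disjunction of literals, treated as a finite set of literals. -/
abbrev Clause (V : Type) : Type := Finset (Literal V)

/-- A CNF formula `C₁ ∧ ⋯ ∧ Cₘ`: a finite collection of clauses, repetitions being allowed. -/
abbrev CNF (V : Type) : Type := Multiset (Clause V)

/-- The assignment `α` falsifies the clause `C`: it makes every literal of `C` false. -/
def Clause.Falsified {V : Type} (C : Clause V) (α : V → Bool) : Prop :=
  ∀ l ∈ C, α l.1 ≠ l.2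

instance {V : Type} (α : V → Bool) : DecidablePred fun C : Clause V => C.Falsified α :=
  fun C => inferInstanceAs (Decidable (∀ l ∈ C, α l.1 ≠ l.2))

/-- The assignment `α` falsifies the formula `F`: it falsifies some clause of `F`. -/
def CNF.Falsified {V : Type} (F : CNF V) (α : V → Bool) : Prop :=
  ∃ C ∈ F, Clause.Falsified C α

/-- `F` is unsatisfiable: every assignment falsifies it. -/
def CNF.Unsatisfiable {V : Type} (F : CNF V) : Prop :=
  ∀ α : V → Bool, F.Falsified α

/-- The number of clauses of `F` (with multiplicity) falsified by `α`. -/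
def CNF.numFalsified {V : Type} (F : CNF V) (α : V → Bool) : ℕ :=
  Multiset.countP (fun C : Clause V => C.Falsified α) F

/-- Odd hitting formula: every falsifying assignment falsifies an odd number of clauses. -/
def CNF.IsOddHitting {V : Type} (F : CNF V) : Prop :=
  ∀ α : V → Bool, F.Falsified α → Odd (F.numFalsified α)

/-- `H` is a refutation of `F` in the Odd Hitting proof system: an unsatisfiable odd hitting
formula each of whose clauses contains a clause of `F`. -/
structure IsOddHittingRefutation {V : Type} (F H : CNF V) : Prop where
  unsat : H.Unsatisfiable
  oddHitting : H.IsOddHitting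
  weakening : ∀ C ∈ H, ∃ C' ∈ F, C' ⊆ C

/-- `E` is the resolvent of `C` (containing `x`) and `D` (containing the negation of `x`). -/
def IsResolvent {V : Type} [DecidableEq V] (C D E : Clause V) : Prop :=
  ∃ x : V, (x, true) ∈ C ∧ (x, false) ∈ D ∧ E = C.erase (x, true) ∪ D.erase (x, false)

/-- `π` is a (dag-like) resolution refutation of `F`: a sequence of clauses, each of which is a
clause of `F` or a resolvent of two earlier clauses, containing the empty clause. -/
structure IsResRefutation {V : Type} [DecidableEq V] (F : CNF V) (π : List (Clause V)) :
    Prop where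
  step : ∀ i : Fin π.length, π.get i ∈ F ∨
    ∃ j k : Fin π.length, j < i ∧ k < i ∧ IsResolvent (π.get j) (π.get k) (π.get i)
  empty_mem : (∅ : Clause V) ∈ π

end OddHit

/-! The formulas are pebbling formulas of bounded-degree acyclic graphs, each variable replaced by
the parity of two. Resolution refutes them by deriving the vertices in topological order
(`exists_isResRefutation`).

For the lower bound, fix one variable of each pair at random. A clause touching `w` vertices escapes
being satisfied with probability at most `(3/4)^w`, so for a small refutation `H` some restriction
satisfies every clause touching more than `d` vertices (`exists_restriction`). Modulo 2, the
falsification indicators of the clauses of `H` sum to 1. The surviving ones are polynomials in at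
most `d` vertex variables, each a multiple of an axiom. Apply the functional that adds the
coefficients of the monomials `S`, for `S` reachable by reversible pebbling with at most `d`
pebbles. It maps 1 to 1. It kills multiples of a vertex axiom, because their monomials pair up along
legal moves (`sum_sum_powerset_eq_zero`), and multiples of the sink axiom, because the sink is
unreachable. Hence `pow_le_card_mul_pow`.

The graph is recursive: two half-size copies and new layers of sources and sinks, joined by
constant-degree expanders. Each level doubles the pebbles needed (`Flow.double`), so height `k`
needs about `2^k` pebbles on `O(2^k * (k + 1))` vertices, that is, order `n / log n`. -/

namespace OddHit

/-! ### Pebbling runs and the doubling argument -/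

section Pebbling

variable {W : Type} [DecidableEq W]

/-- A sequence of pebble configurations in which a pebble is placed on `v` only when all the
predecessors `P v` of `v` carry pebbles, and at most one pebble is placed at a time. -/
structure IsRun (P : W → Finset W) (c : ℕ → Finset W) : Prop where
  place : ∀ t v, v ∈ c (t + 1) → v ∉ c t → P v ⊆ c t
  slow : ∀ t, ∃ v, c (t + 1) ⊆ insert v (c t)

/-- The vertices of `L` on which a pebble is placed in one of the steps `a, …, b - 1`. -/
noncomputable def placed (c : ℕ → Finset W) (L : Finset W) (a b : ℕ) : Finset W :=
  open Classical in L.filter fun v => ∃ t, a ≤ t ∧ t < b ∧ v ∉ c t ∧ v ∈ c (t + 1)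

/-- Every set of `n` vertices of `L` has all but fewer than `n` vertices of `L'` among its
predecessors. -/
def Connects (P : W → Finset W) (L' L : Finset W) (n : ℕ) : Prop :=
  ∀ A ⊆ L, n ≤ A.card → (L' \ A.biUnion P).card < n

/-- Pebbling many vertices of `T`, from a configuration with few pebbles on `V`, needs a time
interval in which `V` always carries `u` pebbles and many vertices of `S` are pebbled. -/
def Flow (P : W → Finset W) (V S T : Finset W) (u : ℕ) : Prop :=
  ∀ c, IsRun P c → ∀ a b, (c a ∩ V).card ≤ 2 * u → 2 * u ≤ (placed c T a b).card →
    ∃ a' b', a ≤ a' ∧ b' ≤ b ∧ (∀ t, a' ≤ t → t < b' → u ≤ (c t ∩ V).card) ∧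
      4 * u ≤ (placed c S a' b').card

omit [DecidableEq W] in
lemma mem_placed {c : ℕ → Finset W} {L : Finset W} {a b : ℕ} {v : W} :
    v ∈ placed c L a b ↔ v ∈ L ∧ ∃ t, a ≤ t ∧ t < b ∧ v ∉ c t ∧ v ∈ c (t + 1) := by
  simp [placed]

omit [DecidableEq W] in
lemma placed_subset (c : ℕ → Finset W) (L : Finset W) (a b : ℕ) : placed c L a b ⊆ L :=
  fun _ hv => (mem_placed.1 hv).1

lemma card_placed_le_add (c : ℕ → Finset W) (L : Finset W) (a s b : ℕ) :
    (placed c L a b).card ≤ (placed c L a s).card + (placed c L s b).card := by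
  refine (Finset.card_le_card ?_).trans (Finset.card_union_le _ _)
  intro v hv
  obtain ⟨h, t, h1, h2, h3⟩ := mem_placed.1 hv
  rcases lt_or_ge t s with hs | hs
  · exact Finset.mem_union_left _ (mem_placed.2 ⟨h, t, h1, hs, h3⟩)
  · exact Finset.mem_union_right _ (mem_placed.2 ⟨h, t, hs, h2, h3⟩)

/-- A vertex which is pebbled at time `t` but not at the earlier time `a` is placed in between. -/
lemma exists_place {c : ℕ → Finset W} {v : W} {a t : ℕ} (hat : a ≤ t) (ha : v ∉ c a)
    (ht : v ∈ c t) : ∃ r, a ≤ r ∧ r < t ∧ v ∉ c r ∧ v ∈ c (r + 1) := by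
  induction t, hat using Nat.le_induction with
  | base => exact absurd ht ha
  | succ t hat ih =>
    by_cases h : v ∈ c t
    · obtain ⟨r, h1, h2, h3⟩ := ih h
      exact ⟨r, h1, by omega, h3⟩
    · exact ⟨t, hat, by omega, h, ht⟩

lemma IsRun.card_le_succ {P : W → Finset W} {c : ℕ → Finset W} (hc : IsRun P c) (V : Finset W)
    (t : ℕ) : (c (t + 1) ∩ V).card ≤ (c t ∩ V).card + 1 := by
  obtain ⟨v, hv⟩ := hc.slow t
  refine (Finset.card_le_card (t := insert v (c t ∩ V)) ?_).trans (Finset.card_insert_le _ _)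
  intro x hx
  have h1 := hv (Finset.mem_inter.1 hx).1
  have h2 := (Finset.mem_inter.1 hx).2
  simp only [Finset.mem_insert, Finset.mem_inter] at h1 ⊢
  tauto

/-- Extending an interval with many pebbles to the left until few pebbles are left. -/
lemma IsRun.exists_left_extension {P : W → Finset W} {c : ℕ → Finset W} (hc : IsRun P c)
    (V : Finset W) {a a' b h H : ℕ} (ha : a ≤ a') (hH : (c a ∩ V).card ≤ H) (hhH : h ≤ H)
    (hhigh : ∀ t, a' ≤ t → t < b → h ≤ (c t ∩ V).card) :
    ∃ a₀, a ≤ a₀ ∧ a₀ ≤ a' ∧ (∀ t, a₀ ≤ t → t < b → h ≤ (c t ∩ V).card) ∧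
      (c a₀ ∩ V).card ≤ H := by
  induction a', ha using Nat.le_induction with
  | base => exact ⟨a, le_rfl, le_rfl, hhigh, hH⟩
  | succ s hs ih =>
    by_cases hlow : h ≤ (c s ∩ V).card
    · obtain ⟨a₀, h1, h2, h3⟩ := ih (fun t ht htb => by
        rcases eq_or_lt_of_le ht with rfl | h
        · exact hlow
        · exact hhigh t h htb)
      exact ⟨a₀, h1, by omega, h3⟩
    · refine ⟨s + 1, by omega, le_rfl, hhigh, ?_⟩
      have := hc.card_le_succ V s
      omega

/-- Placing a vertex requires pebbles on its predecessors, so all but fewer than `n` vertices of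
`L'` carry a pebble at some time of the interval. Each of these was pebbled at time `a` or has been
placed since. -/
lemma IsRun.card_le_of_connects {P : W → Finset W} {c : ℕ → Finset W} (hc : IsRun P c)
    {V L L' : Finset W} {a a' b n : ℕ} (hL' : L' ⊆ V) (hconn : Connects P L' L n) (ha : a ≤ a')
    (hn : n ≤ (placed c L a' b).card) :
    L'.card ≤ n + (c a ∩ V).card + (placed c L' a b).card := by
  have h1 := hconn _ (placed_subset c L a' b) hn
  have h2 : L' ⊆ (L' \ (placed c L a' b).biUnion P) ∪ (c a ∩ V) ∪ placed c L' a b := by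
    intro w hw
    by_cases hw1 : w ∈ (placed c L a' b).biUnion P
    · obtain ⟨v, hv, hwv⟩ := Finset.mem_biUnion.1 hw1
      obtain ⟨-, t, ht1, ht2, ht3, ht4⟩ := mem_placed.1 hv
      have hwt := hc.place t v ht4 ht3 hwv
      by_cases hwa : w ∈ c a
      · simp [hwa, hL' hw]
      · obtain ⟨r, hr1, hr2, hr3⟩ := exists_place (ha.trans ht1) hwa hwt
        exact Finset.mem_union_right _ (mem_placed.2 ⟨hw, r, hr1, hr2.trans ht2, hr3⟩)
    · simp [hw, hw1]
  have h3 := Finset.card_le_card h2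
  have h4 := Finset.card_union_le ((L' \ (placed c L a' b).biUnion P) ∪ (c a ∩ V))
    (placed c L' a b)
  have h5 := Finset.card_union_le (L' \ (placed c L a' b).biUnion P) (c a ∩ V)
  omega

/-- If intervals with at least `h` pebbles on `V` place fewer than `m` pebbles on `L`, then every
interval contains a time with fewer than `h` pebbles, before which fewer than `m` vertices of `L`
are pebbled. -/
lemma exists_first_low {c : ℕ → Finset W} {V L : Finset W} {a b h m : ℕ}
    (hL : ∀ b' ≤ b, (∀ t, a ≤ t → t < b' → h ≤ (c t ∩ V).card) → (placed c L a b').card < m)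
    (hm : m ≤ (placed c L a b).card) :
    ∃ s, a ≤ s ∧ s ≤ b ∧ (c s ∩ V).card < h ∧
      (placed c L a b).card < m + (placed c L s b).card := by
  classical
  have hex : ∃ s, a ≤ s ∧ s < b ∧ (c s ∩ V).card < h := by
    by_contra! hno
    exact absurd (hL b le_rfl hno) (by omega)
  obtain ⟨h1, h2, h3⟩ := Nat.find_spec hex
  have hmin := fun s hs => Nat.find_min hex (m := s) hs
  set s := Nat.find hex
  refine ⟨s, h1, h2.le, h3, ?_⟩
  have h4 := hL s h2.le (fun t hat hts => by
    by_contra! hlt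
    exact hmin t hts ⟨hat, hts.trans h2, hlt⟩)
  have := card_placed_le_add c L a s b
  omega

/-- If the conclusion fails, an interval with `2 * u` pebbles on `V` throughout cannot place `2 * u`
vertices of `T`, `S₁` or `S₂`, as this would force most of `S` to be placed. So `V` drops below `2 *
u` while much of `T` is still to come, which forces `T₂` and, by the flow in `V₂`, `S₂`. A second
drop inside that interval forces `T₁` and then `S₁`. The two flow intervals are nested, so `V₁` and
`V₂` together hold `2 * u` pebbles while `S₁` is placed, a contradiction. -/
theorem Flow.double {P : W → Finset W} {V S T V₁ S₁ T₁ V₂ S₂ T₂ : Finset W} {u : ℕ}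
    (hf₁ : Flow P V₁ S₁ T₁ u) (hf₂ : Flow P V₂ S₂ T₂ u)
    (hV₁ : V₁ ⊆ V) (hV₂ : V₂ ⊆ V) (hdisj : Disjoint V₁ V₂) (hSV : S ⊆ V)
    (hT₁V : T₁ ⊆ V₁) (hT₂V : T₂ ⊆ V₂)
    (hS : S.card = 16 * u) (hT₁ : T₁.card = 8 * u) (hT₂ : T₂.card = 8 * u)
    (hSS₁ : Connects P S S₁ (2 * u)) (hSS₂ : Connects P S S₂ (2 * u))
    (hST : Connects P S T (2 * u)) (hTS : Connects P T₁ S₂ (2 * u))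
    (hTT : Connects P T₂ T (2 * u)) : Flow P V S T (2 * u) := by
  intro c hc a b ha hT
  by_contra hno
  have huniv : ∀ L, Connects P S L (2 * u) → ∀ a' b', a ≤ a' → b' ≤ b →
      (∀ t, a' ≤ t → t < b' → 2 * u ≤ (c t ∩ V).card) → (placed c L a' b').card < 2 * u := by
    intro L hL a' b' haa hbb hhigh
    by_contra! hge
    -- The extended interval starts with at most `4 * u` pebbles, so at least `16 * u - 2 * u - 4 *
    -- u` vertices of `S` are placed; `8 * u` would do.
    obtain ⟨a₀, h1, h2, h3, h4⟩ :=
      hc.exists_left_extension V (h := 2 * u) haa ha (by omega) hhigh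
    have h5 := hc.card_le_of_connects hSV hL h2 hge
    exact hno ⟨a₀, b', h1, hbb, h3, by omega⟩
  have hmono : ∀ {X Y : Finset W} (t : ℕ), X ⊆ Y → (c t ∩ X).card ≤ (c t ∩ Y).card :=
    fun t h => Finset.card_le_card (Finset.inter_subset_inter_left h)
  obtain ⟨s₁, hs1, hs1b, hs2, hs3⟩ := exists_first_low (c := c) (V := V) (L := T) (a := a) (b := b)
    (h := 2 * u) (m := 2 * u) (fun b' hb' hh => huniv T hST a b' le_rfl hb' hh) (by omega)
  -- More than `2 * u` vertices of `T` are placed after `s₁`, so more than `8 * u - 2 * u - 2 * u`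
  -- vertices of `T₂` are.
  have hs4 := hc.card_le_of_connects hT₂V hTT (le_refl s₁) (b := b) (by omega)
  have hs5 := hmono s₁ hV₂
  obtain ⟨a₂, b₂, h21, h22, h23, h24⟩ := hf₂ c hc s₁ b (by omega) (by omega)
  obtain ⟨s₂, hs6, hs6b, hs7, hs8⟩ := exists_first_low (c := c) (V := V) (L := S₂) (a := a₂)
    (b := b₂) (h := 2 * u) (m := 2 * u)
    (fun b' hb' hh => huniv S₂ hSS₂ a₂ b' (by omega) (by omega) hh) (by omega)
  have hs9 := hc.card_le_of_connects hT₁V hTS (le_refl s₂) (b := b₂) (by omega)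
  have hs10 := hmono s₂ hV₁
  obtain ⟨a₁, b₁, h11, h12, h13, h14⟩ := hf₁ c hc s₂ b₂ (by omega) (by omega)
  have := huniv S₁ hSS₁ a₁ b₁ (by omega) (by omega) (fun t ht htb => by
    have e1 := h13 t ht htb
    have e2 := h23 t (by omega) (by omega)
    have e3 : (c t ∩ V₁).card + (c t ∩ V₂).card ≤ (c t ∩ V).card := by
      rw [← Finset.card_union_of_disjoint
        (hdisj.mono Finset.inter_subset_right Finset.inter_subset_right)]
      refine Finset.card_le_card (Finset.union_subset ?_ ?_)
      · exact Finset.inter_subset_inter_left hV₁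
      · exact Finset.inter_subset_inter_left hV₂
    omega)
  rcases Nat.eq_zero_or_pos u with rfl | hu
  · omega
  · omega

theorem Flow.of_complete {P : W → Finset W} {V S T : Finset W} (hSV : S ⊆ V) (hS : S.card = 8)
    (hP : ∀ v ∈ T, S ⊆ P v) : Flow P V S T 1 := by
  intro c hc a b ha hT
  obtain ⟨v, hv⟩ := Finset.card_pos.1 (show 0 < (placed c T a b).card by omega)
  obtain ⟨hvT, t, ht1, ht2, ht3, ht4⟩ := mem_placed.1 hv
  have hSt : S ⊆ c t := (hP v hvT).trans (hc.place t v ht4 ht3)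
  -- Extend the empty interval at `t`. It then starts with at most 2 pebbles, so at least 6 of the 8
  -- vertices of `S` are placed in it.
  obtain ⟨a₀, h1, h2, h3, h4⟩ := hc.exists_left_extension V (h := 1) (b := t) ht1 ha (by omega)
    (fun r hr hrt => absurd hrt (by omega))
  refine ⟨a₀, t, h1, ht2.le, h3, ?_⟩
  have h5 : S ⊆ (c a₀ ∩ V) ∪ placed c S a₀ t := by
    intro w hw
    by_cases hwa : w ∈ c a₀
    · simp [hwa, hSV hw]
    · exact Finset.mem_union_right _ (mem_placed.2 ⟨hw, exists_place h2 hwa (hSt hw)⟩)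
  have h6 := (Finset.card_le_card h5).trans (Finset.card_union_le _ _)
  omega

end Pebbling

/-! ### Bipartite expanders by counting -/

section Expander

/-- A bipartite graph of constant degree on `8 * m + 8 * m` vertices in which any two sets of `m`
vertices on the two sides are joined by an edge. -/
theorem exists_expander_fin (m : ℕ) (hm : 0 < m) :
    ∃ f : Fin (8 * m) → Fin 84 → Fin (8 * m), ∀ A B : Finset (Fin (8 * m)),
      A.card = m → B.card = m → ∃ a ∈ A, ∃ i, f a i ∈ B := by
  classical
  by_contra! hno
  let bad : Finset (Fin (8 * m)) × Finset (Fin (8 * m)) →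
      Finset (Fin (8 * m) → Fin 84 → Fin (8 * m)) := fun p =>
    Fintype.piFinset fun a => if a ∈ p.1 then Fintype.piFinset fun _ => p.2ᶜ else Finset.univ
  let I : Finset (Finset (Fin (8 * m)) × Finset (Fin (8 * m))) :=
    Finset.univ.filter fun p => p.1.card = m ∧ p.2.card = m
  have hcover : (Finset.univ : Finset (Fin (8 * m) → Fin 84 → Fin (8 * m))) ⊆ I.biUnion bad := by
    intro f _
    obtain ⟨A, B, hA, hB, hf⟩ := hno f
    refine Finset.mem_biUnion.2 ⟨(A, B), by simp [I, hA, hB], ?_⟩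
    refine Fintype.mem_piFinset.2 fun a => ?_
    by_cases ha : a ∈ A
    · simpa [ha] using hf a ha
    · simp [ha]
  have hbad : ∀ p ∈ I, (bad p).card ≤ (7 * m) ^ (84 * m) * (8 * m) ^ (84 * (7 * m)) := by
    rintro ⟨A, B⟩ hp
    obtain ⟨hA, hB⟩ : A.card = m ∧ B.card = m := by simpa [I] using hp
    have hBc : Bᶜ.card = 7 * m := by
      rw [Finset.card_compl, hB, Fintype.card_fin]; omega
    have hAc : Aᶜ.card = 7 * m := by
      rw [Finset.card_compl, hA, Fintype.card_fin]; omega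
    have h1 : (bad (A, B)).card =
        ∏ a : Fin (8 * m), if a ∈ A then (7 * m) ^ 84 else (8 * m) ^ 84 := by
      rw [Fintype.card_piFinset]
      refine Finset.prod_congr rfl fun a _ => ?_
      split_ifs with ha
      · simp [hBc]
      · simp
    rw [h1, Finset.prod_ite]
    have h2 : (Finset.univ.filter fun a => a ∈ A) = A := by ext; simp
    have h3 : (Finset.univ.filter fun a => a ∉ A) = Aᶜ := by ext; simp
    rw [h2, h3, Finset.prod_const, Finset.prod_const, hA, hAc, ← pow_mul, ← pow_mul]
  have hI : I.card ≤ 2 ^ (16 * m) := by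
    refine (Finset.card_le_univ I).trans ?_
    simp only [Fintype.card_prod, Fintype.card_finset, Fintype.card_fin]
    rw [← pow_add]
    exact Nat.pow_le_pow_right (by norm_num) (by omega)
  have htot := (Finset.card_le_card hcover).trans
    (Finset.card_biUnion_le_card_mul I bad _ hbad)
  have htot2 := htot.trans (Nat.mul_le_mul_right _ hI)
  simp only [Finset.card_univ, Fintype.card_pi, Finset.prod_const, Fintype.card_fin] at htot2
  have e1 : ((8 * m) ^ 84) ^ (8 * m) = (8 ^ 84) ^ m * (m ^ (84 * m) * (8 * m) ^ (84 * (7 * m))) := by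
    have : (8 * m) = m + 7 * m := by omega
    conv_lhs => rw [this, pow_add, ← this, ← pow_mul, ← pow_mul, mul_pow, pow_mul]
    ring
  have e2 : 2 ^ (16 * m) * ((7 * m) ^ (84 * m) * (8 * m) ^ (84 * (7 * m))) =
      (2 ^ 16 * 7 ^ 84) ^ m * (m ^ (84 * m) * (8 * m) ^ (84 * (7 * m))) := by
    rw [mul_pow 7 m, mul_pow (2 ^ 16), ← pow_mul, ← pow_mul]
    ring
  rw [e1, e2] at htot2
  have e3 : (8 ^ 84) ^ m ≤ (2 ^ 16 * 7 ^ 84) ^ m :=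
    Nat.le_of_mul_le_mul_right htot2 (by positivity)
  -- The union bound closes because `2 ^ 16 * 7 ^ 84 < 8 ^ 84`; 84 is the least exponent for which
  -- this holds.
  exact absurd e3 (not_le.2 (Nat.pow_lt_pow_left (by norm_num) hm.ne'))

theorem exists_expander (m : ℕ) (hm : 0 < m) :
    ∃ E : ℕ → Finset ℕ, (∀ j, (E j).card ≤ 84) ∧
      ∀ A B, A ⊆ Finset.range (8 * m) → B ⊆ Finset.range (8 * m) → m ≤ A.card → m ≤ B.card →
        ∃ a ∈ A, ∃ b ∈ B, b ∈ E a := by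
  classical
  obtain ⟨f, hf⟩ := exists_expander_fin m hm
  refine ⟨fun j => if h : j < 8 * m then Finset.univ.image fun i => (f ⟨j, h⟩ i : ℕ) else ∅,
    fun j => ?_, fun A B hA hB hAm hBm => ?_⟩
  · dsimp only
    split_ifs
    · exact Finset.card_image_le.trans (by simp)
    · simp
  · obtain ⟨A', hA', hA'm⟩ := Finset.exists_subset_card_eq hAm
    obtain ⟨B', hB', hB'm⟩ := Finset.exists_subset_card_eq hBm
    have hlift : ∀ X, X ⊆ Finset.range (8 * m) → X.card = m →
        (Finset.univ.filter fun x : Fin (8 * m) => (x : ℕ) ∈ X).card = m := by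
      intro X hX hXm
      refine Eq.trans ?_ hXm
      refine Finset.card_bij (fun x _ => (x : ℕ)) (by simp) (fun x _ y _ h => Fin.ext h) ?_
      intro x hx
      exact ⟨⟨x, Finset.mem_range.1 (hX hx)⟩, by simpa using hx, rfl⟩
    obtain ⟨a, ha, i, hi⟩ := hf _ _ (hlift A' (hA'.trans hA) hA'm) (hlift B' (hB'.trans hB) hB'm)
    refine ⟨a, hA' (by simpa using ha), f a i, hB' (by simpa using hi), ?_⟩
    simp

/-- A family of bipartite graphs of bounded degree on `8 * 2 ^ i + 8 * 2 ^ i` vertices, complete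
for `i = 0` and joining any two sets of `2 ^ i` vertices on the two sides. -/
structure IsExpanderFamily (E : ℕ → ℕ → Finset ℕ) : Prop where
  degree : ∀ i j, (E i j).card ≤ 84
  expand : ∀ i A B, A ⊆ Finset.range (8 * 2 ^ i) → B ⊆ Finset.range (8 * 2 ^ i) →
    2 ^ i ≤ A.card → 2 ^ i ≤ B.card → ∃ a ∈ A, ∃ b ∈ B, b ∈ E i a
  complete : ∀ j, E 0 j = Finset.range 8

theorem exists_isExpanderFamily : ∃ E, IsExpanderFamily E := by
  choose F hF using fun i : ℕ => exists_expander (2 ^ i) (by positivity)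
  refine ⟨fun i => if i = 0 then fun _ => Finset.range 8 else F i, fun i j => ?_,
    fun i A B hA hB hAc hBc => ?_, fun j => by simp⟩
  · by_cases h : i = 0
    · simp [h]
    · simpa [h] using (hF i).1 j
  · by_cases h : i = 0
    · subst h
      obtain ⟨a, ha⟩ := Finset.card_pos.1 (show 0 < A.card by simpa using hAc)
      obtain ⟨b, hb⟩ := Finset.card_pos.1 (show 0 < B.card by simpa using hBc)
      exact ⟨a, ha, b, hb, by simpa using hB hb⟩
    · simpa [h] using (hF i).2 A B hA hB hAc hBc

end Expander

/-! ### The recursive pebbling graph -/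

section Graph

/-- The vertices of the pebbling graph: `(p, s, j)` is the `j`-th source (`s = false`) or sink
(`s = true`) of the subgraph with address `p`; its two halves are `false :: p` and `true :: p`. -/
abbrev Vertex : Type := List Bool × Bool × ℕ

/-- The first `n` sources or sinks of the subgraph with address `p`. -/
def layer (p : List Bool) (s : Bool) (n : ℕ) : Finset Vertex :=
  (Finset.range n).image fun j => (p, s, j)

/-- The subgraph of height `i` with address `p`. -/
def block : ℕ → List Bool → Finset Vertex
  | 0, p => layer p false 8 ∪ layer p true 8
  | i + 1, p => layer p false (8 * 2 ^ (i + 1)) ∪ layer p true (8 * 2 ^ (i + 1)) ∪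
      (block i (false :: p) ∪ block i (true :: p))

/-- The edges of the pebbling graph of height `k`, built from the bipartite graphs `E`. -/
inductive Edge (k : ℕ) (E : ℕ → ℕ → Finset ℕ) : Vertex → Vertex → Prop
  | source_sink (p j j') : j' ∈ E (k - p.length) j → Edge k E (p, false, j') (p, true, j)
  | source_source (p b j j') : j' ∈ E (k - p.length) j →
      Edge k E (p, false, j') (b :: p, false, j)
  | sink_source (p j j') : j' ∈ E (k - p.length) j →
      Edge k E (false :: p, true, j') (true :: p, false, j)
  | sink_sink (p j j') : j' ∈ E (k - p.length) j → Edge k E (true :: p, true, j') (p, true, j)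

/-- The predecessors of `v` in the pebbling graph of height `k`. -/
noncomputable def preds (k : ℕ) (E : ℕ → ℕ → Finset ℕ) (v : Vertex) : Finset Vertex :=
  open Classical in (block k []).filter fun u => Edge k E u v

variable {k : ℕ} {E : ℕ → ℕ → Finset ℕ}

lemma mem_layer {p : List Bool} {s : Bool} {n : ℕ} {v : Vertex} :
    v ∈ layer p s n ↔ ∃ j < n, v = (p, s, j) := by
  simp [layer, eq_comm]

lemma card_layer (p : List Bool) (s : Bool) (n : ℕ) : (layer p s n).card = n := by
  rw [layer, Finset.card_image_of_injective _ (fun a b h => by simpa using h), Finset.card_range]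

lemma mem_preds {u v : Vertex} : u ∈ preds k E v ↔ u ∈ block k [] ∧ Edge k E u v := by
  simp [preds]

lemma card_block (i : ℕ) (p : List Bool) : (block i p).card ≤ 16 * (2 ^ i * (i + 1)) := by
  induction i generalizing p with
  | zero =>
    refine (Finset.card_union_le _ _).trans ?_
    simp [card_layer]
  | succ i ih =>
    have h0 := ih (false :: p)
    have h1 := ih (true :: p)
    have h2 := Finset.card_union_le (layer p false (8 * 2 ^ (i + 1)))
      (layer p true (8 * 2 ^ (i + 1)))
    have h3 := Finset.card_union_le (block i (false :: p)) (block i (true :: p))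
    rw [block]
    refine (Finset.card_union_le _ _).trans ?_
    rw [card_layer, card_layer] at h2
    ring_nf at *
    omega

lemma layer_subset_block (i : ℕ) (p : List Bool) (s : Bool) :
    layer p s (8 * 2 ^ i) ⊆ block i p := by
  cases i <;> cases s <;> intro v hv <;> simp_all [block]

lemma suffix_of_mem_block {i : ℕ} {p : List Bool} {v : Vertex} (hv : v ∈ block i p) :
    p <:+ v.1 := by
  induction i generalizing p with
  | zero =>
    rcases Finset.mem_union.1 hv with h | h <;> obtain ⟨j, -, rfl⟩ := mem_layer.1 h <;> simp
  | succ i ih =>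
    rw [block, Finset.mem_union, Finset.mem_union, Finset.mem_union] at hv
    rcases hv with (h | h) | h | h
    · obtain ⟨j, -, rfl⟩ := mem_layer.1 h; simp
    · obtain ⟨j, -, rfl⟩ := mem_layer.1 h; simp
    · exact (List.suffix_cons _ _).trans (ih h)
    · exact (List.suffix_cons _ _).trans (ih h)

lemma disjoint_block (i : ℕ) (p : List Bool) :
    Disjoint (block i (false :: p)) (block i (true :: p)) := by
  refine Finset.disjoint_left.2 fun v h0 h1 => ?_
  have e0 := suffix_of_mem_block h0
  have e1 := suffix_of_mem_block h1
  have := List.suffix_of_suffix_length_le e0 e1 (by simp)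
  have := this.eq_of_length (by simp)
  simp at this

/-- Expansion concerns arbitrary index sets, so it survives truncating either layer. This matters
because the layers of a half are shorter than the expander of the block containing it. -/
lemma connects_layer (hE : IsExpanderFamily E) {i n n' : ℕ} {p q : List Bool} {s s' : Bool}
    (hn : n ≤ 8 * 2 ^ i) (hn' : n' ≤ 8 * 2 ^ i) (hV : layer p s' n' ⊆ block k [])
    (hedge : ∀ j j', j' ∈ E i j → Edge k E (p, s', j') (q, s, j)) :
    Connects (preds k E) (layer p s' n') (layer q s n) (2 ^ i) := by
  intro A hA hAc
  by_contra! hB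
  have hcard : ∀ {X : Finset Vertex} {r t m}, X ⊆ layer r t m →
      X.card = (X.image fun v => v.2.2).card := by
    intro X r t m hX
    refine (Finset.card_image_of_injOn fun x hx y hy h => ?_).symm
    obtain ⟨a, -, rfl⟩ := mem_layer.1 (hX hx)
    obtain ⟨b, -, rfl⟩ := mem_layer.1 (hX hy)
    simp_all
  have hrange : ∀ {X : Finset Vertex} {r t m}, X ⊆ layer r t m → m ≤ 8 * 2 ^ i →
      (X.image fun v => v.2.2) ⊆ Finset.range (8 * 2 ^ i) := by
    intro X r t m hX hm x hx
    obtain ⟨v, hv, rfl⟩ := Finset.mem_image.1 hx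
    obtain ⟨a, ha, rfl⟩ := mem_layer.1 (hX hv)
    exact Finset.mem_range.2 (ha.trans_le hm)
  have hsub : layer p s' n' \ A.biUnion (preds k E) ⊆ layer p s' n' := Finset.sdiff_subset
  obtain ⟨a, ha, b, hb, hab⟩ := hE.expand i _ _ (hrange hA hn) (hrange hsub hn')
    (by rwa [← hcard hA]) (by rwa [← hcard hsub])
  obtain ⟨v, hv, rfl⟩ := Finset.mem_image.1 ha
  obtain ⟨w, hw, rfl⟩ := Finset.mem_image.1 hb
  obtain ⟨x, hx, rfl⟩ := mem_layer.1 (hA hv)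
  obtain ⟨y, hy, rfl⟩ := mem_layer.1 (hsub hw)
  refine (Finset.mem_sdiff.1 hw).2 (Finset.mem_biUnion.2 ⟨_, hv, mem_preds.2 ⟨?_, ?_⟩⟩)
  · exact hV (hsub hw)
  · exact hedge _ _ hab

/-- Induction by `Flow.double`, the `false` half before the `true` half. Even the edges between the
halves use the expander of the larger block, whence the threshold `2 * 2 ^ i`. -/
theorem flow_block (hE : IsExpanderFamily E) (i : ℕ) (p : List Bool) (hp : p.length + i = k)
    (hV : block i p ⊆ block k []) :
    Flow (preds k E) (block i p) (layer p false (8 * 2 ^ i)) (layer p true (8 * 2 ^ i))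
      (2 ^ i) := by
  induction i generalizing p with
  | zero =>
    refine Flow.of_complete (layer_subset_block 0 p false) (card_layer _ _ _) ?_
    intro v hv u hu
    refine mem_preds.2 ⟨hV (layer_subset_block 0 p false hu), ?_⟩
    obtain ⟨x, -, rfl⟩ := mem_layer.1 hv
    obtain ⟨y, hy, rfl⟩ := mem_layer.1 hu
    have : k - p.length = 0 := by omega
    refine Edge.source_sink _ _ _ ?_
    rw [this, hE.complete]
    simpa using hy
  | succ i ih =>
    have hsub : ∀ b, block i (b :: p) ⊆ block (i + 1) p := by
      intro b; cases b <;> intro v hv <;> simp [block, hv]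
    have hf := fun b => ih (b :: p) (by simp; omega) ((hsub b).trans hV)
    have hk : k - p.length = i + 1 := by omega
    have h1 : 8 * 2 ^ i ≤ 8 * 2 ^ (i + 1) := by rw [pow_succ]; omega
    have hS : layer p false (8 * 2 ^ (i + 1)) ⊆ block k [] :=
      (layer_subset_block (i + 1) p false).trans hV
    have hT : ∀ b, layer (b :: p) true (8 * 2 ^ i) ⊆ block k [] := fun b =>
      (layer_subset_block i (b :: p) true).trans ((hsub b).trans hV)
    have key := Flow.double (hf false) (hf true) (V := block (i + 1) p)
      (S := layer p false (8 * 2 ^ (i + 1))) (T := layer p true (8 * 2 ^ (i + 1)))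
      (hsub false) (hsub true) (disjoint_block i p) (layer_subset_block (i + 1) p false)
      (layer_subset_block i _ true) (layer_subset_block i _ true)
      (by rw [card_layer, pow_succ]; ring) (card_layer _ _ _) (card_layer _ _ _)
    rw [← pow_succ'] at key
    refine key ?_ ?_ ?_ ?_ ?_
    · exact connects_layer hE h1 le_rfl hS fun j j' h => Edge.source_source _ _ _ _ (hk ▸ h)
    · exact connects_layer hE h1 le_rfl hS fun j j' h => Edge.source_source _ _ _ _ (hk ▸ h)
    · exact connects_layer hE le_rfl le_rfl hS fun j j' h => Edge.source_sink _ _ _ (hk ▸ h)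
    · exact connects_layer hE h1 h1 (hT _) fun j j' h => Edge.sink_source _ _ _ (hk ▸ h)
    · exact connects_layer hE le_rfl h1 (hT _) fun j j' h => Edge.sink_sink _ _ _ (hk ▸ h)

/-- At most two expander neighbourhoods feed a vertex: a sink is fed from the sources of its block
and the sinks of the `true` half, a source from the sources of the parent and possibly the sinks of
its sibling. -/
theorem card_preds (hE : IsExpanderFamily E) (v : Vertex) : (preds k E v).card ≤ 168 := by
  have hbound : ∀ (f g : ℕ → Vertex) (X : Finset ℕ), X.card ≤ 84 →
      (∀ u, Edge k E u v → u ∈ X.image f ∪ X.image g) → (preds k E v).card ≤ 168 := by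
    intro f g X hX h
    refine (Finset.card_le_card fun u hu => h u (mem_preds.1 hu).2).trans ?_
    refine (Finset.card_union_le _ _).trans ?_
    have h1 : (X.image f).card ≤ X.card := Finset.card_image_le
    have h2 : (X.image g).card ≤ X.card := Finset.card_image_le
    omega
  obtain ⟨p, s, j⟩ := v
  cases s with
  | true =>
    refine hbound (fun x => (p, false, x)) (fun x => (true :: p, true, x)) _
      (hE.degree (k - p.length) j) fun u hu => ?_
    cases hu <;> simp_all
  | false =>
    cases p with
    | nil =>
      exact hbound (fun x => ([], false, x)) (fun x => ([], false, x)) ∅ (by simp)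
        fun u hu => by cases hu
    | cons b p =>
      refine hbound (fun x => (p, false, x)) (fun x => (false :: p, true, x)) _
        (hE.degree (k - p.length) j) fun u hu => ?_
      cases hu <;> simp_all

lemma lt_of_mem_block {i : ℕ} {p : List Bool} {v : Vertex} (hv : v ∈ block i p) :
    v.1.length ≤ p.length + i ∧ v.2.2 < 8 * 2 ^ (p.length + i - v.1.length) := by
  induction i generalizing p with
  | zero =>
    rcases Finset.mem_union.1 hv with h | h <;> obtain ⟨j, hj, rfl⟩ := mem_layer.1 h <;> simpa
  | succ i ih =>
    rw [block, Finset.mem_union, Finset.mem_union, Finset.mem_union] at hv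
    rcases hv with (h | h) | h | h
    · obtain ⟨j, hj, rfl⟩ := mem_layer.1 h; simpa using hj
    · obtain ⟨j, hj, rfl⟩ := mem_layer.1 h; simpa using hj
    · simpa [add_assoc, add_comm 1] using ih h
    · simpa [add_assoc, add_comm 1] using ih h

/-- The topological order of a block is: sources, `false` half, `true` half, sinks. -/
lemma block_subset_of_layer_subset {D : Finset Vertex}
    (hD : ∀ v ∈ block k [], preds k E v ⊆ D → v ∈ D) (i : ℕ) (p : List Bool)
    (hp : p.length + i = k) (hV : block i p ⊆ block k []) (hS : layer p false (8 * 2 ^ i) ⊆ D) :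
    block i p ⊆ D := by
  have hlayer : ∀ i p s, block i p ⊆ block k [] →
      (∀ j u, u ∈ block k [] → Edge k E u (p, s, j) → u ∈ D) → layer p s (8 * 2 ^ i) ⊆ D := by
    intro i p s hV h v hv
    obtain ⟨j, -, rfl⟩ := mem_layer.1 hv
    exact hD _ (hV (layer_subset_block i p s hv)) fun u hu =>
      h j u (mem_preds.1 hu).1 (mem_preds.1 hu).2
  -- An expander may list indices beyond a layer; membership of the predecessor in the block bounds
  -- its index.
  have hmem : ∀ {i p s j}, p.length + i = k → layer p s (8 * 2 ^ i) ⊆ D →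
      ((p, s, j) : Vertex) ∈ block k [] → ((p, s, j) : Vertex) ∈ D := by
    intro i p s j hp h hv
    refine h (mem_layer.2 ⟨j, ?_, rfl⟩)
    have := (lt_of_mem_block hv).2
    rwa [List.length_nil, zero_add, show k - p.length = i by omega] at this
  induction i generalizing p with
  | zero =>
    refine Finset.union_subset hS (hlayer 0 p true hV fun j u hu he => ?_)
    cases he with
    | source_sink => exact hmem hp hS hu
    | sink_sink =>
      have := (lt_of_mem_block hu).1
      simp at this
      omega
  | succ i ih =>
    have hsub : ∀ b, block i (b :: p) ⊆ block (i + 1) p := by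
      intro b; cases b <;> intro v hv <;> simp [block, hv]
    have hlen : ∀ b, (b :: p).length + i = k := fun b => by simp; omega
    have h0 : block i (false :: p) ⊆ D := by
      refine ih _ (hlen _) ((hsub _).trans hV) (hlayer i _ _ ((hsub _).trans hV) fun j u hu he => ?_)
      cases he with
      | source_source => exact hmem hp hS hu
    have hT : ∀ b, block i (b :: p) ⊆ D → layer (b :: p) true (8 * 2 ^ i) ⊆ D := fun b h =>
      (layer_subset_block i _ true).trans h
    have h1 : block i (true :: p) ⊆ D := by
      refine ih _ (hlen _) ((hsub _).trans hV) (hlayer i _ _ ((hsub _).trans hV) fun j u hu he => ?_)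
      cases he with
      | source_source => exact hmem hp hS hu
      | sink_source => exact hmem (hlen _) (hT _ h0) hu
    refine Finset.union_subset (Finset.union_subset hS ?_) (Finset.union_subset h0 h1)
    refine hlayer (i + 1) p true hV fun j u hu he => ?_
    cases he with
    | source_sink => exact hmem hp hS hu
    | sink_sink => exact hmem (hlen _) (hT _ h1) hu

/-- Every vertex is reached by repeatedly adding vertices all of whose predecessors are there. -/
theorem block_subset_of_closed {D : Finset Vertex}
    (hD : ∀ v ∈ block k [], preds k E v ⊆ D → v ∈ D) : block k [] ⊆ D := by
  refine block_subset_of_layer_subset hD k [] (by simp) subset_rfl fun v hv => ?_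
  obtain ⟨j, -, rfl⟩ := mem_layer.1 hv
  refine hD _ (layer_subset_block k [] false hv) fun u hu => ?_
  cases (mem_preds.1 hu).2

end Graph

/-! ### Reversible pebbling and the parity functional -/

section ParityBound

variable {U : Type} [DecidableEq U]

/-- Reversible pebbling configurations reachable from `∅` with at most `d` pebbles. -/
inductive Reachable (P : U → Finset U) (d : ℕ) : Finset U → Prop
  | empty : Reachable P d ∅
  | place {S v} : Reachable P d S → v ∉ S → P v ⊆ S → (insert v S).card ≤ d →
      Reachable P d (insert v S)
  | remove {S v} : Reachable P d (insert v S) → v ∉ S → P v ⊆ S → Reachable P d S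

lemma reachable_insert_iff {P : U → Finset U} {d : ℕ} {S : Finset U} {v : U} (hv : v ∉ S)
    (hP : P v ⊆ S) (hd : (insert v S).card ≤ d) :
    Reachable P d S ↔ Reachable P d (insert v S) :=
  ⟨fun h => h.place hv hP hd, fun h => h.remove hv hP⟩

lemma Reachable.card_le {P : U → Finset U} {d : ℕ} {S : Finset U} (h : Reachable P d S) :
    S.card ≤ d := by
  induction h with
  | empty => simp
  | place _ _ _ h => exact h
  | remove _ _ _ ih => exact (Finset.card_le_card (Finset.subset_insert _ _)).trans ih

/-- The terms `f` of a sum over configurations `R` cancel if `f` only depends on `D` and vanishes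
outside the assignments `Y` with `p ⊆ Y`, `v ∉ Y`, and `R` is closed under changing `v`. -/
theorem sum_sum_powerset_eq_zero (R : Finset (Finset U))
    (D p : Finset U) (v : U) (f : Finset U → ZMod 2) (hdep : ∀ Y, f (Y ∩ D) = f Y)
    (hf : ∀ Y, f Y ≠ 0 → p ⊆ Y ∧ v ∉ Y)
    (hR : ∀ S ⊆ D, p ⊆ S → v ∉ S → (S ∈ R ↔ insert v S ∈ R)) (hv : v ∈ D) :
    ∑ S ∈ R, ∑ Y ∈ S.powerset, f Y = 0 := by
  -- The inner sum is the coefficient of the monomial `S` in `f` modulo 2, by Möbius inversion.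
  have hcancel : ∀ S : Finset U, ¬ S ⊆ D → ∑ Y ∈ S.powerset, f Y = 0 := by
    intro S hS
    obtain ⟨w, hwS, hwD⟩ := Finset.not_subset.1 hS
    have hw : ∀ Y, f (insert w Y) = f Y := fun Y => by
      rw [← hdep, Finset.insert_inter_of_notMem hwD, hdep]
    rw [← Finset.insert_erase hwS, Finset.sum_powerset_insert (Finset.notMem_erase w S),
      ← Finset.sum_add_distrib]
    refine Finset.sum_eq_zero fun Y _ => ?_
    rw [hw, CharTwo.add_self_eq_zero]
  have hp : ∀ S : Finset U, ¬ p ⊆ S → ∑ Y ∈ S.powerset, f Y = 0 := by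
    intro S hS
    refine Finset.sum_eq_zero fun Y hY => ?_
    by_contra h
    exact hS ((hf Y h).1.trans (Finset.mem_powerset.1 hY))
  have hins : ∀ S : Finset U, v ∉ S →
      ∑ Y ∈ (insert v S).powerset, f Y = ∑ Y ∈ S.powerset, f Y := by
    intro S hS
    rw [Finset.sum_powerset_insert hS, add_eq_left]
    refine Finset.sum_eq_zero fun Y _ => ?_
    by_contra h
    exact (hf _ h).2 (Finset.mem_insert_self v Y)
  by_cases hvp : v ∈ p
  · refine Finset.sum_eq_zero fun S _ => Finset.sum_eq_zero fun Y _ => ?_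
    by_contra h
    exact (hf Y h).2 ((hf Y h).1 hvp)
  have hfilter : ∑ S ∈ R, ∑ Y ∈ S.powerset, f Y =
      ∑ S ∈ R with S ⊆ D ∧ p ⊆ S, ∑ Y ∈ S.powerset, f Y := by
    refine (Finset.sum_filter_of_ne fun S _ h => ⟨?_, ?_⟩).symm
    · exact not_not.1 fun h' => h (hcancel S h')
    · exact not_not.1 fun h' => h (hp S h')
  rw [hfilter]
  -- By `hins`, toggling `v` preserves the coefficient, so the terms cancel in pairs.
  refine Finset.sum_involution (fun S _ => if v ∈ S then S.erase v else insert v S) ?_ ?_ ?_ ?_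
  · intro S hS
    split_ifs with h
    · have := hins (S.erase v) (Finset.notMem_erase v S)
      rw [Finset.insert_erase h] at this
      rw [this, CharTwo.add_self_eq_zero]
    · rw [hins S h, CharTwo.add_self_eq_zero]
  · intro S hS _ h
    split_ifs at h with hvS
    · exact Finset.erase_ne_self.2 hvS h
    · exact Finset.insert_ne_self.2 hvS h
  · intro S hS
    obtain ⟨hSR, hSD, hpS⟩ := Finset.mem_filter.1 hS
    split_ifs with hvS
    · have hsub : S.erase v ⊆ D := (Finset.erase_subset v S).trans hSD
      have hps : p ⊆ S.erase v := Finset.subset_erase.2 ⟨hpS, hvp⟩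
      refine Finset.mem_filter.2 ⟨(hR _ hsub hps (Finset.notMem_erase v S)).2 ?_, hsub, hps⟩
      rwa [Finset.insert_erase hvS]
    · exact Finset.mem_filter.2 ⟨(hR S hSD hpS hvS).1 hSR, Finset.insert_subset hv hSD,
        hpS.trans (Finset.subset_insert v S)⟩
  · intro S hS
    by_cases hvS : v ∈ S
    · simp [hvS, Finset.insert_erase]
    · simp [hvS]

/-- A bounded run can be continued at any time by a legal move to a small configuration. -/
lemma IsRun.exists_continuation {P : U → Finset U} {d n : ℕ} {c : ℕ → Finset U} {S : Finset U}
    (hc : IsRun P c) (hd : ∀ t, (c t).card ≤ d) (hS : S.card ≤ d)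
    (hplace : ∀ v ∈ S, v ∉ c n → P v ⊆ c n) (hslow : ∃ v, S ⊆ insert v (c n)) :
    ∃ c', IsRun P c' ∧ (∀ t, (c' t).card ≤ d) ∧ (∀ t ≤ n, c' t = c t) ∧ c' (n + 1) = S := by
  refine ⟨fun t => if t ≤ n then c t else S, ⟨fun t v => ?_, fun t => ?_⟩, fun t => ?_,
    fun t ht => by simp [ht], by simp⟩
  · rcases lt_trichotomy t n with h | rfl | h
    · simpa [h.le, Nat.succ_le_of_lt h] using hc.place t v
    · simpa using hplace v
    · simpa [h.not_ge, (h.trans (Nat.lt_succ_self t)).not_ge] using fun h1 h2 => absurd h1 h2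
  · rcases lt_trichotomy t n with h | rfl | h
    · simpa [h.le, Nat.succ_le_of_lt h] using hc.slow t
    · simpa using hslow
    · obtain ⟨v, -⟩ := hslow
      exact ⟨v, by simp [h.not_ge, (h.trans (Nat.lt_succ_self t)).not_ge]⟩
  · dsimp only
    split_ifs
    exacts [hd t, hS]

lemma Reachable.exists_run {P : U → Finset U} {d n : ℕ} {c : ℕ → Finset U} {S : Finset U}
    (h : Reachable P d S) (hc : IsRun P c) (hd : ∀ t, (c t).card ≤ d) (hn : c n = ∅) :
    ∃ c' n', IsRun P c' ∧ (∀ t, (c' t).card ≤ d) ∧ n ≤ n' ∧ (∀ t ≤ n, c' t = c t) ∧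
      c' n' = S := by
  induction h with
  | empty => exact ⟨c, n, hc, hd, le_rfl, fun _ _ => rfl, hn⟩
  | @place S v _ hv hP hcard ih =>
    obtain ⟨c', n', hc', hd', hnn', heq, rfl⟩ := ih
    obtain ⟨c'', h1, h2, h3, h4⟩ := hc'.exists_continuation (n := n') hd' hcard (by
      intro x hx hxS
      rcases Finset.mem_insert.1 hx with rfl | hx
      · exact hP
      · exact absurd hx hxS) ⟨v, subset_rfl⟩
    exact ⟨c'', n' + 1, h1, h2, by omega, fun t ht => by rw [h3 t (by omega), heq t ht], h4⟩
  | @remove S v hr hv hP ih =>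
    obtain ⟨c', n', hc', hd', hnn', heq, hS⟩ := ih
    obtain ⟨c'', h1, h2, h3, h4⟩ := hc'.exists_continuation (n := n') hd'
      (S := S) (hr.remove hv hP).card_le (by
        intro x hx hxS
        exact absurd (hS ▸ Finset.mem_insert_of_mem hx) hxS)
      ⟨v, by rw [hS]; exact (Finset.subset_insert _ _).trans (Finset.subset_insert _ _)⟩
    exact ⟨c'', n' + 1, h1, h2, by omega, fun t ht => by rw [h3 t (by omega), heq t ht], h4⟩

/-- Concatenate one pebbling per vertex, emptying the board in a single step in between: a run,
unlike a reversible pebbling, removes pebbles freely. -/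
lemma exists_run_visiting {P : U → Finset U} {d : ℕ} (A : Finset U)
    (hA : ∀ t ∈ A, ∃ S, Reachable P d S ∧ t ∈ S) (hne : Nonempty U) :
    ∃ c n, IsRun P c ∧ (∀ t, (c t).card ≤ d) ∧ c 0 = ∅ ∧ c n = ∅ ∧
      ∀ v ∈ A, ∃ r < n, v ∈ c r := by
  induction A using Finset.induction_on with
  | empty =>
    exact ⟨fun _ => ∅, 0, ⟨by simp, fun _ => ⟨hne.some, by simp⟩⟩, by simp, rfl, rfl, by simp⟩
  | insert x A _ ih =>
    obtain ⟨c, n, hc, hd, h0, hn, hvis⟩ := ih fun t ht => hA t (Finset.mem_insert_of_mem ht)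
    obtain ⟨S, hS, hxS⟩ := hA x (Finset.mem_insert_self x A)
    obtain ⟨c', n', hc', hd', hnn', heq, rfl⟩ := hS.exists_run hc hd hn
    obtain ⟨c'', h1, h2, h3, h4⟩ := hc'.exists_continuation (n := n') hd' (S := ∅) (by simp)
      (by simp) ⟨x, by simp⟩
    refine ⟨c'', n' + 1, h1, h2, by rw [h3 0 (by omega), heq 0 (by omega), h0], h4, ?_⟩
    intro v hv
    rcases Finset.mem_insert.1 hv with rfl | hv
    · exact ⟨n', by omega, by rwa [h3 n' le_rfl]⟩
    · obtain ⟨r, hr, hvr⟩ := hvis v hv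
      exact ⟨r, by omega, by rwa [h3 r (by omega), heq r hr.le]⟩

/-- Otherwise a single run with at most `d` pebbles places all of `T`, whereas the flow exhibits a
time with `u > d` pebbles. -/
theorem Flow.exists_unreachable {P : U → Finset U} {V S T : Finset U} {u d : ℕ}
    (hf : Flow P V S T u) (hT : 2 * u ≤ T.card) (hd : d < u) :
    ∃ t ∈ T, ∀ S, Reachable P d S → t ∉ S := by
  by_contra! hno
  obtain ⟨x, -⟩ := Finset.card_pos.1 (show 0 < T.card by omega)
  obtain ⟨c, n, hc, hcd, h0, hn, hvis⟩ := exists_run_visiting T hno ⟨x⟩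
  have hplaced : placed c T 0 n = T := by
    refine (placed_subset c T 0 n).antisymm fun v hv => ?_
    obtain ⟨r, hr, hvr⟩ := hvis v hv
    obtain ⟨s, h1, h2, h3⟩ := exists_place (Nat.zero_le r) (by simp [h0]) hvr
    exact mem_placed.2 ⟨hv, s, h1, h2.trans hr, h3⟩
  obtain ⟨a, b, -, -, hhigh, hS⟩ := hf c hc 0 n (by simp [h0]) (by rwa [hplaced])
  obtain ⟨v, hv⟩ := Finset.card_pos.1 (show 0 < (placed c S a b).card by omega)
  obtain ⟨-, t, h1, h2, -⟩ := mem_placed.1 hv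
  have h3 := hhigh t h1 h2
  have h4 := Finset.card_le_card (Finset.inter_subset_left (s₁ := c t) (s₂ := V))
  have h5 := hcd t
  omega

end ParityBound

/-! ### Pebbling formulas with parities substituted -/

section Formula

variable {U X : Type} [DecidableEq U] [DecidableEq X]

/-- The clause over the variables `B` falsified exactly by the assignments agreeing with `β`. -/
def forbid (B : Finset X) (β : X → Bool) : Clause X :=
  B.image fun x => (x, !β x)

/-- Every vertex `v` gets the two variables `ι (v, true)` and `ι (v, false)`. -/
def vars (ι : U × Bool → X) (A : Finset U) : Finset X :=
  (A ×ˢ Finset.univ).image ι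

/-- The truth value of the vertex `v`: the parity of its two variables. -/
def value (ι : U × Bool → X) (β : X → Bool) (v : U) : Bool :=
  xor (β (ι (v, true))) (β (ι (v, false)))

/-- The clauses saying that `v` is true if all its predecessors are. -/
def vertexClauses [Fintype X] (ι : U × Bool → X) (P : U → Finset U) (v : U) :
    Finset (Clause X) :=
  (Finset.univ.filter fun β : X → Bool =>
    (∀ u ∈ P v, value ι β u = true) ∧ value ι β v = false).image
      (forbid (vars ι (insert v (P v))))

/-- The clauses saying that `t` is false. -/
def sinkClauses [Fintype X] (ι : U × Bool → X) (t : U) : Finset (Clause X) :=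
  (Finset.univ.filter fun β : X → Bool => value ι β t = true).image (forbid (vars ι {t}))

/-- The pebbling formula of the graph `P` with sink `t`, each variable of which is replaced by the
parity of two variables. -/
def pebblingFormula [Fintype U] [Fintype X] (ι : U × Bool → X) (P : U → Finset U) (t : U) :
    Finset (Clause X) :=
  Finset.univ.biUnion (vertexClauses ι P) ∪ sinkClauses ι t

omit [DecidableEq U] in
lemma mem_vars {ι : U × Bool → X} {A : Finset U} {x : X} :
    x ∈ vars ι A ↔ ∃ v ∈ A, ∃ b, ι (v, b) = x := by
  simp [vars]

lemma mem_vertexClauses [Fintype X] {ι : U × Bool → X} {P : U → Finset U} {v : U}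
    {C : Clause X} : C ∈ vertexClauses ι P v ↔ ∃ β : X → Bool, ((∀ u ∈ P v, value ι β u = true) ∧
      value ι β v = false) ∧ forbid (vars ι (insert v (P v))) β = C := by
  simp [vertexClauses]

omit [DecidableEq U] in
lemma mem_sinkClauses [Fintype X] {ι : U × Bool → X} {t : U} {C : Clause X} :
    C ∈ sinkClauses ι t ↔ ∃ β : X → Bool, value ι β t = true ∧ forbid (vars ι {t}) β = C := by
  simp [sinkClauses]

lemma mem_forbid {B : Finset X} {β : X → Bool} {l : Literal X} :
    l ∈ forbid B β ↔ l.1 ∈ B ∧ l.2 = !β l.1 := by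
  obtain ⟨x, b⟩ := l
  simp only [forbid, Finset.mem_image, Prod.mk.injEq]
  constructor
  · rintro ⟨y, hy, rfl, rfl⟩
    exact ⟨hy, rfl⟩
  · rintro ⟨hx, rfl⟩
    exact ⟨x, hx, rfl, rfl⟩

lemma falsified_forbid {B : Finset X} {β α : X → Bool} :
    Clause.Falsified (forbid B β) α ↔ ∀ x ∈ B, α x = β x := by
  constructor
  · intro h x hx
    have := h (x, !β x) (mem_forbid.2 ⟨hx, rfl⟩)
    simpa using this
  · rintro h ⟨x, b⟩ hl
    obtain ⟨hx, hb⟩ := mem_forbid.1 hl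
    simp only at hx hb
    simp [h x hx, hb]

lemma card_image_forbid_le (B : Finset X) (s : Finset (X → Bool)) :
    (s.image (forbid B)).card ≤ 2 ^ B.card := by
  rw [← Finset.card_powerset]
  refine (Finset.card_le_card (t := B.powerset.image fun Y => forbid B fun x => decide (x ∈ Y))
    fun C hC => ?_).trans Finset.card_image_le
  obtain ⟨β, -, rfl⟩ := Finset.mem_image.1 hC
  refine Finset.mem_image.2 ⟨B.filter fun x => β x = true, by simp, ?_⟩
  ext l
  simp only [mem_forbid, Finset.mem_filter]
  refine and_congr_right fun hl => ?_
  simp [hl]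

omit [DecidableEq U] in
lemma value_congr {ι : U × Bool → X} {A : Finset U} {α β : X → Bool}
    (h : ∀ x ∈ vars ι A, α x = β x) {v : U} (hv : v ∈ A) : value ι α v = value ι β v := by
  rw [value, value, h _ (mem_vars.2 ⟨v, hv, true, rfl⟩), h _ (mem_vars.2 ⟨v, hv, false, rfl⟩)]

end Formula

/-! ### Restrictions and the odd hitting lower bound -/

section LowerBound

variable {U X : Type} [DecidableEq U] [DecidableEq X] [Fintype U]

/-- The vertices one of whose variables occurs in `C`. -/
noncomputable def touched (ι : U × Bool → X) (C : Clause X) : Finset U :=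
  open Classical in Finset.univ.filter fun v => ∃ b z, (ι (v, b), z) ∈ C

/-- The restrictions, fixing one variable of every vertex, which satisfy no literal of `C`. -/
noncomputable def surviving (ι : U × Bool → X) (C : Clause X) : Finset (U → Bool × Bool) :=
  Fintype.piFinset fun v => Finset.univ.filter fun z => (ι (v, z.1), z.2) ∉ C

omit [DecidableEq U] in
lemma mem_touched {ι : U × Bool → X} {C : Clause X} {v : U} :
    v ∈ touched ι C ↔ ∃ b z, (ι (v, b), z) ∈ C := by
  simp [touched]

/-- At a touched vertex, at least one of the four choices satisfies `C`. -/
lemma card_surviving_le (ι : U × Bool → X) (C : Clause X) {w : ℕ}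
    (hw : w ≤ (touched ι C).card) :
    4 ^ w * (surviving ι C).card ≤ 3 ^ w * 4 ^ Fintype.card U := by
  have h1 : (surviving ι C).card ≤ ∏ v : U, if v ∈ touched ι C then 3 else 4 := by
    rw [surviving, Fintype.card_piFinset]
    refine Finset.prod_le_prod' fun v _ => ?_
    split_ifs with hv
    · obtain ⟨b, z, hbz⟩ := mem_touched.1 hv
      have : (Finset.univ.filter fun z : Bool × Bool => (ι (v, z.1), z.2) ∉ C) ⊆
          Finset.univ.erase (b, z) := by
        intro y hy
        refine Finset.mem_erase.2 ⟨?_, Finset.mem_univ _⟩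
        rintro rfl
        exact (Finset.mem_filter.1 hy).2 hbz
      simpa using Finset.card_le_card this
    · exact (Finset.card_le_univ _).trans (by simp)
  have h2 : (∏ v : U, if v ∈ touched ι C then 3 else 4) =
      3 ^ (touched ι C).card * 4 ^ (Fintype.card U - (touched ι C).card) := by
    rw [Finset.prod_ite, Finset.prod_const, Finset.prod_const, ← Finset.card_compl]
    congr 3 <;> ext <;> simp
  obtain ⟨m, hm⟩ := Nat.exists_eq_add_of_le hw
  have h3 : (touched ι C).card ≤ Fintype.card U := Finset.card_le_univ _
  obtain ⟨r, hr⟩ := Nat.exists_eq_add_of_le h3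
  rw [h2, hr, Nat.add_sub_cancel_left, hm] at h1
  rw [hr, hm]
  calc 4 ^ w * (surviving ι C).card ≤ 4 ^ w * (3 ^ (w + m) * 4 ^ r) := Nat.mul_le_mul_left _ h1
    _ = 3 ^ w * (4 ^ w * 3 ^ m * 4 ^ r) := by ring
    _ ≤ 3 ^ w * (4 ^ w * 4 ^ m * 4 ^ r) := by gcongr; norm_num
    _ = 3 ^ w * 4 ^ (w + m + r) := by ring

/-- The assignment extending the restriction `ρ` in which exactly the vertices of `Y` are true. -/
noncomputable def lift (ι : U × Bool → X) (ρ : U → Bool × Bool) (Y : Finset U) : X → Bool :=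
  Function.extend ι
    (fun z => if z.2 = (ρ z.1).1 then (ρ z.1).2 else xor (ρ z.1).2 (decide (z.1 ∈ Y)))
    fun _ => false

omit [DecidableEq X] [Fintype U] in
lemma lift_apply {ι : U × Bool → X} (hι : ι.Injective) (ρ : U → Bool × Bool) (Y : Finset U)
    (v : U) (b : Bool) : lift ι ρ Y (ι (v, b)) =
      if b = (ρ v).1 then (ρ v).2 else xor (ρ v).2 (decide (v ∈ Y)) := by
  rw [lift, hι.extend_apply]

omit [DecidableEq X] [Fintype U] in
lemma value_lift {ι : U × Bool → X} (hι : ι.Injective) (ρ : U → Bool × Bool) (Y : Finset U)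
    (v : U) : value ι (lift ι ρ Y) v = decide (v ∈ Y) := by
  rw [value, lift_apply hι, lift_apply hι]
  rcases ρ v with ⟨_ | _, _ | _⟩ <;> simp

lemma falsified_lift_inter {ι : U × Bool → X} (hι : ι.Injective) (ρ : U → Bool × Bool)
    (Y : Finset U) (C : Clause X) :
    Clause.Falsified C (lift ι ρ (Y ∩ touched ι C)) ↔ Clause.Falsified C (lift ι ρ Y) := by
  refine forall₂_congr fun l hl => ?_
  obtain ⟨x, z⟩ := l
  suffices lift ι ρ (Y ∩ touched ι C) x = lift ι ρ Y x by rw [this]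
  by_cases hx : ∃ y, ι y = x
  · obtain ⟨⟨v, b⟩, rfl⟩ := hx
    have : v ∈ touched ι C := mem_touched.2 ⟨b, z, hl⟩
    simp [lift_apply hι, this]
  · rw [lift, lift, Function.extend_apply' _ _ _ hx, Function.extend_apply' _ _ _ hx]

lemma exists_restriction (ι : U × Bool → X) (H : CNF X) {w : ℕ} (hH : H.card * 3 ^ w < 4 ^ w) :
    ∃ ρ : U → Bool × Bool, ∀ C ∈ H, w ≤ (touched ι C).card → ρ ∉ surviving ι C := by
  classical
  by_contra! hno
  let K := H.toFinset.filter fun C => w ≤ (touched ι C).card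
  have hcover : (Finset.univ : Finset (U → Bool × Bool)) ⊆ K.biUnion (surviving ι) := by
    intro ρ _
    obtain ⟨C, hC, hw, hρ⟩ := hno ρ
    exact Finset.mem_biUnion.2 ⟨C, by simp [K, hC, hw], hρ⟩
  have h1 : 4 ^ Fintype.card U ≤ ∑ C ∈ K, (surviving ι C).card := by
    have := (Finset.card_le_card hcover).trans Finset.card_biUnion_le
    simpa using this
  have h2 : K.card ≤ H.card :=
    (Finset.card_le_card (Finset.filter_subset _ _)).trans (Multiset.toFinset_card_le H)
  have h3 : 4 ^ w * ∑ C ∈ K, (surviving ι C).card ≤ K.card * (3 ^ w * 4 ^ Fintype.card U) := by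
    rw [Finset.mul_sum, ← smul_eq_mul, ← Finset.sum_const]
    exact Finset.sum_le_sum fun C hC => card_surviving_le ι C (Finset.mem_filter.1 hC).2
  have h4 : 4 ^ w * 4 ^ Fintype.card U ≤ H.card * 3 ^ w * 4 ^ Fintype.card U := by
    calc _ ≤ _ := Nat.mul_le_mul_left _ h1
      _ ≤ _ := h3
      _ ≤ H.card * (3 ^ w * 4 ^ Fintype.card U) := Nat.mul_le_mul_right _ h2
      _ = _ := by ring
  exact absurd (Nat.le_of_mul_le_mul_right h4 (by positivity)) (not_le.2 hH)

/-- Odd hitting refutations of the pebbling formula are exponentially large in the number of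
pebbles needed to reach the sink. -/
theorem pow_le_card_mul_pow [Fintype X] {ι : U × Bool → X} (hι : ι.Injective)
    {P : U → Finset U} {t : U} {d : ℕ} (ht : ∀ S, Reachable P d S → t ∉ S) {H : CNF X}
    (hH : IsOddHittingRefutation (pebblingFormula ι P t).val H) :
    4 ^ (d + 1) ≤ H.card * 3 ^ (d + 1) := by
  classical
  by_contra! hlt
  obtain ⟨ρ, hρ⟩ := exists_restriction ι H hlt
  let R : Finset (Finset U) := Finset.univ.filter (Reachable P d)
  have hR : ∀ {S}, S ∈ R ↔ Reachable P d S := by simp [R]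
  let f : Clause X → Finset U → ZMod 2 := fun C Y =>
    if Clause.Falsified C (lift ι ρ Y) then 1 else 0
  have hf : ∀ {C Y}, f C Y ≠ 0 → Clause.Falsified C (lift ι ρ Y) := by
    intro C Y h
    by_contra h'
    exact h (if_neg h')
  have hsum : ∀ Y, (H.map fun C => f C Y).sum = 1 := by
    intro Y
    have h1 := hH.oddHitting _ (hH.unsat (lift ι ρ Y))
    have h2 : (H.map fun C => f C Y).sum = (H.numFalsified (lift ι ρ Y) : ZMod 2) := by
      simp only [CNF.numFalsified]
      generalize H = K
      induction K using Multiset.induction_on with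
      | empty => simp
      | cons C K ih =>
        rw [Multiset.map_cons, Multiset.sum_cons, ih, Multiset.countP_cons]
        simp only [f]
        split_ifs <;> simp [add_comm]
    rw [h2]
    exact (ZMod.natCast_eq_one_iff_odd).2 h1
  have hone : ∑ S ∈ R, ∑ Y ∈ S.powerset, (H.map fun C => f C Y).sum = 1 := by
    simp only [hsum]
    -- A nonempty `S` has an even number of subsets, so only `∅` contributes.
    rw [Finset.sum_eq_single_of_mem ∅ (hR.2 Reachable.empty)]
    · simp
    · intro S _ hS
      obtain ⟨x, hx⟩ := Finset.nonempty_iff_ne_empty.2 hS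
      have : S.card ≠ 0 := Finset.card_ne_zero_of_mem hx
      have h2 : (2 : ZMod 2) = 0 := by decide
      simp [h2, this]
  have hswap : ∑ S ∈ R, ∑ Y ∈ S.powerset, (H.map fun C => f C Y).sum =
      (H.map fun C => ∑ S ∈ R, ∑ Y ∈ S.powerset, f C Y).sum := by
    generalize H = K
    induction K using Multiset.induction_on with
    | empty => simp
    | cons C K ih => simp [Finset.sum_add_distrib, ih]
  have hzero : ∀ C ∈ H, ∑ S ∈ R, ∑ Y ∈ S.powerset, f C Y = 0 := by
    intro C hC
    rcases lt_or_ge (touched ι C).card (d + 1) with hw | hw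
    · have htouch : ∀ {A β}, forbid (vars ι A) β ⊆ C → A ⊆ touched ι C := fun {A β} h v hv =>
        mem_touched.2 ⟨true, !β (ι (v, true)), h (mem_forbid.2 ⟨mem_vars.2 ⟨v, hv, true, rfl⟩, rfl⟩)⟩
      have hval : ∀ {A β Y}, forbid (vars ι A) β ⊆ C → f C Y ≠ 0 → ∀ v ∈ A,
          decide (v ∈ Y) = value ι β v := by
        intro A β Y h hY v hv
        have h1 := falsified_forbid.1 fun l hl => hf hY l (h hl)
        rw [← value_lift hι ρ Y v]
        exact value_congr h1 hv
      obtain ⟨C', hC', hsub⟩ := hH.weakening C hC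
      replace hC' : C' ∈ pebblingFormula ι P t := hC'
      rcases Finset.mem_union.1 hC' with h | h
      · obtain ⟨v, -, h⟩ := Finset.mem_biUnion.1 h
        obtain ⟨β, ⟨hβP, hβv⟩, rfl⟩ := mem_vertexClauses.1 h
        have hD := htouch hsub
        refine sum_sum_powerset_eq_zero R (touched ι C) (P v) v (f C) (fun Y => ?_)
          (fun Y hY => ⟨fun u hu => ?_, ?_⟩) (fun S hSD hPS hvS => ?_)
          (hD (Finset.mem_insert_self _ _))
        · simp only [f, falsified_lift_inter hι]
        · have := hval hsub hY u (Finset.mem_insert_of_mem hu)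
          rw [hβP u hu] at this
          simpa using this
        · have := hval hsub hY v (Finset.mem_insert_self _ _)
          rw [hβv] at this
          simpa using this
        · rw [hR, hR]
          -- The enlarged configuration lies in the touched set, so narrowness of `C` keeps the move
          -- within `d` pebbles.
          refine reachable_insert_iff hvS hPS ?_
          have := Finset.card_le_card
            (Finset.insert_subset (hD (Finset.mem_insert_self _ _)) hSD)
          omega
      · obtain ⟨β, hβt, rfl⟩ := mem_sinkClauses.1 h
        refine Finset.sum_eq_zero fun S hS => Finset.sum_eq_zero fun Y hY => ?_
        by_contra hne
        have := hval hsub hne t (Finset.mem_singleton_self t)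
        rw [hβt] at this
        exact ht S (hR.1 hS) (Finset.mem_powerset.1 hY (by simpa using this))
    · refine Finset.sum_eq_zero fun S _ => Finset.sum_eq_zero fun Y _ => ?_
      by_contra hne
      refine hρ C hC hw (Fintype.mem_piFinset.2 fun v => ?_)
      refine Finset.mem_filter.2 ⟨Finset.mem_univ _, fun hmem => ?_⟩
      exact hf hne _ hmem (by simp [lift_apply hι])
  rw [hswap, Multiset.sum_eq_zero] at hone
  · exact absurd hone (by decide)
  · intro x hx
    obtain ⟨C, hC, rfl⟩ := Multiset.mem_map.1 hx
    exact hzero C hC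

end LowerBound

/-! ### Resolution by exhaustive branching -/

section Resolution

variable {X : Type} [DecidableEq X]

/-- `π` is a sequence of clauses, each of which is a clause of `F` or a resolvent of two earlier
ones. -/
def IsDerivation (F : CNF X) (π : List (Clause X)) : Prop :=
  ∀ i : Fin π.length, π.get i ∈ F ∨
    ∃ j k : Fin π.length, j < i ∧ k < i ∧ IsResolvent (π.get j) (π.get k) (π.get i)

lemma IsDerivation.concat {F : CNF X} {π : List (Clause X)} (h : IsDerivation F π) {E : Clause X}
    (hE : E ∈ F ∨ ∃ C ∈ π, ∃ D ∈ π, IsResolvent C D E) : IsDerivation F (π ++ [E]) := by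
  have hlen : (π ++ [E]).length = π.length + 1 := by simp
  have hget : ∀ (i : ℕ) (hi : i < π.length), (π ++ [E])[i]'(by omega) = π[i] :=
    fun i hi => List.getElem_append_left hi
  rintro ⟨i, hi⟩
  simp only [List.get_eq_getElem]
  rcases lt_or_ge i π.length with hlt | hge
  · rw [hget i hlt]
    rcases h ⟨i, hlt⟩ with h | ⟨⟨j, hj⟩, ⟨k, hk⟩, hji, hki, hres⟩
    · exact Or.inl h
    · refine Or.inr ⟨⟨j, by omega⟩, ⟨k, by omega⟩, hji, hki, ?_⟩
      rw [hget j hj, hget k hk]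
      exact hres
  · obtain rfl : i = π.length := by omega
    rw [List.getElem_concat_length rfl]
    refine hE.imp_right ?_
    rintro ⟨C, hC, D, hD, hres⟩
    obtain ⟨j, hj, rfl⟩ := List.getElem_of_mem hC
    obtain ⟨k, hk, rfl⟩ := List.getElem_of_mem hD
    refine ⟨⟨j, by omega⟩, ⟨k, by omega⟩, hj, hk, ?_⟩
    rwa [hget j hj, hget k hk]

lemma isDerivation_of_subset {F : CNF X} (l : List (Clause X)) (hl : ∀ C ∈ l, C ∈ F) :
    IsDerivation F l :=
  fun i => Or.inl (hl _ (List.get_mem l i))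

/-- Resolving over all the variables `Y`: if every assignment extending `β` on `B` to `B ∪ Y`
falsifies a derived clause, then a subclause of the clause forbidding `β` on `B` is derivable. -/
theorem IsDerivation.exists_subset_forbid {F : CNF X} (Y : Finset X) :
    ∀ (B : Finset X) (β : X → Bool) (π : List (Clause X)), IsDerivation F π →
      (∀ γ : X → Bool, (∀ x ∈ B, γ x = β x) → ∃ C ∈ π, C ⊆ forbid (B ∪ Y) γ) →
      ∃ π', IsDerivation F π' ∧ π ⊆ π' ∧ π'.length + 1 ≤ π.length + 2 ^ Y.card ∧
        ∃ C ∈ π', C ⊆ forbid B β := by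
  induction Y using Finset.induction_on with
  | empty =>
    intro B β π hπ h
    exact ⟨π, hπ, fun _ => id, by simp, by simpa using h β fun _ _ => rfl⟩
  | insert y Y hy ih =>
    intro B β π hπ h
    have hext : ∀ (z : Bool) (π₀ : List (Clause X)), π ⊆ π₀ → y ∉ B →
        ∀ γ : X → Bool, (∀ x ∈ insert y B, γ x = Function.update β y z x) →
          ∃ C ∈ π₀, C ⊆ forbid (insert y B ∪ Y) γ := by
      intro z π₀ hsub hyB γ hγ
      obtain ⟨C, hC, hCs⟩ := h γ fun x hx => by
        rw [hγ x (Finset.mem_insert_of_mem hx), Function.update_of_ne]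
        rintro rfl
        exact hyB hx
      exact ⟨C, hsub hC, by rwa [Finset.insert_union, ← Finset.union_insert]⟩
    have hpow : 2 ^ (insert y Y).card = 2 ^ Y.card + 2 ^ Y.card := by
      rw [Finset.card_insert_of_notMem hy, pow_succ]; ring
    have hpos : 0 < 2 ^ Y.card := by positivity
    by_cases hyB : y ∈ B
    · obtain ⟨π', h1, h2, h3, h4⟩ := ih B β π hπ (by
        simpa [Finset.union_insert, Finset.insert_eq_of_mem, hyB] using h)
      exact ⟨π', h1, h2, by omega, h4⟩
    -- Branch on `y`, the second branch continuing the derivation of the first. One final resolution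
    -- gives at most `2 ^ |Y| - 1` new clauses over the recursion; it is skipped if a branch does
    -- not mention `y`.
    obtain ⟨π₁, hd₁, hs₁, hl₁, C₁, hC₁, hC₁s⟩ :=
      ih (insert y B) (Function.update β y true) π hπ (hext true π (fun _ => id) hyB)
    obtain ⟨π₂, hd₂, hs₂, hl₂, C₂, hC₂, hC₂s⟩ :=
      ih (insert y B) (Function.update β y false) π₁ hd₁ (hext false π₁ hs₁ hyB)
    have hred : ∀ {C z}, C ⊆ forbid (insert y B) (Function.update β y z) →
        C.erase (y, !z) ⊆ forbid B β := by
      rintro C z hC ⟨x, b⟩ hl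
      obtain ⟨hne, hl⟩ := Finset.mem_erase.1 hl
      obtain ⟨hx, hb⟩ := mem_forbid.1 (hC hl)
      simp only at hx hb
      rcases Finset.mem_insert.1 hx with rfl | hxB
      · simp at hb
        exact absurd (by rw [hb]) hne
      · have : x ≠ y := by rintro rfl; exact hyB hxB
        rw [Function.update_of_ne this] at hb
        exact mem_forbid.2 ⟨hxB, hb⟩
    by_cases h₁ : (y, false) ∈ C₁
    · by_cases h₂ : (y, true) ∈ C₂
      · refine ⟨π₂ ++ [C₂.erase (y, true) ∪ C₁.erase (y, false)], hd₂.concat (Or.inr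
          ⟨C₂, hC₂, C₁, hs₂ hC₁, y, h₂, h₁, rfl⟩), fun C hC => ?_, ?_, _,
          List.mem_append_right _ (List.mem_singleton_self _), ?_⟩
        · exact List.mem_append_left _ (hs₂ (hs₁ hC))
        · rw [List.length_append, List.length_singleton]
          omega
        · exact Finset.union_subset (hred hC₂s) (hred hC₁s)
      · refine ⟨π₂, hd₂, fun C hC => hs₂ (hs₁ hC), by omega, C₂, hC₂, ?_⟩
        have := hred hC₂s
        rwa [Bool.not_false, Finset.erase_eq_of_notMem h₂] at this
    · refine ⟨π₁, hd₁, hs₁, by omega, C₁, hC₁, ?_⟩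
      have := hred hC₁s
      rwa [Bool.not_true, Finset.erase_eq_of_notMem h₁] at this

end Resolution

/-! ### Short resolution refutations -/

section UpperBound

variable {U X : Type} [DecidableEq U] [DecidableEq X]

lemma forbid_mono {B B' : Finset X} (h : B ⊆ B') (β : X → Bool) : forbid B β ⊆ forbid B' β :=
  Finset.image_subset_image h

omit [DecidableEq U] in
lemma vars_mono (ι : U × Bool → X) {A A' : Finset U} (h : A ⊆ A') : vars ι A ⊆ vars ι A' :=
  Finset.image_subset_image (Finset.product_subset_product_left h)

omit [DecidableEq U] in
lemma card_vars_le (ι : U × Bool → X) (A : Finset U) : (vars ι A).card ≤ A.card * 2 :=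
  Finset.card_image_le.trans (by simp)

/-- The clauses in `π` imply that the vertex `v` is true. -/
def Derives (ι : U × Bool → X) (π : List (Clause X)) (v : U) : Prop :=
  ∀ β : X → Bool, value ι β v = false → ∃ C ∈ π, C ⊆ forbid (vars ι {v}) β

omit [DecidableEq U] in
lemma Derives.mono {ι : U × Bool → X} {π π' : List (Clause X)} {v : U} (h : Derives ι π v)
    (hπ : π ⊆ π') : Derives ι π' v := fun β hβ =>
  let ⟨C, hC, hs⟩ := h β hβ
  ⟨C, hπ hC, hs⟩

variable [Fintype X]

omit [Fintype X] in
/-- Deriving the clauses in a finite family, each at cost at most `K`. -/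
lemma IsDerivation.exists_forall {F : CNF X} {K : ℕ} (s : Finset (Clause X))
    {π : List (Clause X)} (hπ : IsDerivation F π)
    (h : ∀ E ∈ s, ∀ π₀, IsDerivation F π₀ → π ⊆ π₀ →
      ∃ π', IsDerivation F π' ∧ π₀ ⊆ π' ∧ π'.length ≤ π₀.length + K ∧ ∃ C ∈ π', C ⊆ E) :
    ∃ π', IsDerivation F π' ∧ π ⊆ π' ∧ π'.length ≤ π.length + s.card * K ∧
      ∀ E ∈ s, ∃ C ∈ π', C ⊆ E := by
  induction s using Finset.induction_on with
  | empty => exact ⟨π, hπ, fun _ => id, by simp, by simp⟩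
  | insert E s hE ih =>
    obtain ⟨π₁, h1, h2, h3, h4⟩ := ih fun E' hE' => h E' (Finset.mem_insert_of_mem hE')
    obtain ⟨π₂, h5, h6, h7, h8⟩ := h E (Finset.mem_insert_self E s) π₁ h1 h2
    refine ⟨π₂, h5, fun C hC => h6 (h2 hC), ?_, fun E' hE' => ?_⟩
    · rw [Finset.card_insert_of_notMem hE, add_mul]
      omega
    · rcases Finset.mem_insert.1 hE' with rfl | hE'
      · exact h8
      · obtain ⟨C, hC, hs⟩ := h4 E' hE'
        exact ⟨C, h6 hC, hs⟩

/-- Branch over the variables of the predecessors: either all are true and a vertex clause of `v` is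
falsified, or one is false and a clause already derived for it is. At most four target clauses
arise. -/
lemma IsDerivation.exists_derives {ι : U × Bool → X} {P : U → Finset U} {F : CNF X}
    {π : List (Clause X)} {m : ℕ} (hπ : IsDerivation F π) (v : U) (hm : (P v).card ≤ m)
    (hv : ∀ C ∈ vertexClauses ι P v, C ∈ π) (hP : ∀ u ∈ P v, Derives ι π u) :
    ∃ π', IsDerivation F π' ∧ π ⊆ π' ∧ π'.length ≤ π.length + 4 * 2 ^ (2 * m) ∧
      Derives ι π' v := by
  let s : Finset (Clause X) :=
    (Finset.univ.filter fun β : X → Bool => value ι β v = false).image (forbid (vars ι {v}))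
  have hs : s.card ≤ 4 := by
    refine (card_image_forbid_le _ _).trans ?_
    have := card_vars_le ι {v}
    rw [Finset.card_singleton] at this
    exact (Nat.pow_le_pow_right (by norm_num) this).trans (by norm_num)
  obtain ⟨π', h1, h2, h3, h4⟩ := hπ.exists_forall (K := 2 ^ (2 * m)) s (by
    intro E hE π₀ hπ₀ hsub
    obtain ⟨β, hβ, rfl⟩ := Finset.mem_image.1 hE
    have hβv : value ι β v = false := (Finset.mem_filter.1 hβ).2
    obtain ⟨π', h1, h2, h3, h4⟩ := IsDerivation.exists_subset_forbid (vars ι (P v))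
      (vars ι {v}) β π₀ hπ₀ (by
        intro γ hγ
        have hγv : value ι γ v = false := by
          rw [value_congr hγ (Finset.mem_singleton_self v), hβv]
        have hunion : vars ι {v} ∪ vars ι (P v) = vars ι (insert v (P v)) := by
          rw [vars, vars, vars, ← Finset.image_union, ← Finset.union_product,
            ← Finset.insert_eq]
        by_cases hall : ∀ u ∈ P v, value ι γ u = true
        · refine ⟨_, hsub (hv _ (mem_vertexClauses.2 ⟨γ, ⟨hall, hγv⟩, rfl⟩)), ?_⟩
          rw [hunion]
        · push Not at hall
          obtain ⟨u, hu, hγu⟩ := hall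
          obtain ⟨C, hC, hCs⟩ := hP u hu γ (by simpa using hγu)
          refine ⟨C, hsub hC, hCs.trans (forbid_mono ?_ γ)⟩
          exact (vars_mono ι (Finset.singleton_subset_iff.2 hu)).trans
            Finset.subset_union_right)
    refine ⟨π', h1, h2, ?_, h4⟩
    have h5 : (vars ι (P v)).card ≤ 2 * m := (card_vars_le ι (P v)).trans (by omega)
    have h6 : 2 ^ (vars ι (P v)).card ≤ 2 ^ (2 * m) := Nat.pow_le_pow_right (by norm_num) h5
    omega)
  refine ⟨π', h1, h2, h3.trans ?_, fun β hβ => h4 _ (Finset.mem_image.2 ⟨β, by simpa, rfl⟩)⟩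
  exact Nat.add_le_add_left (Nat.mul_le_mul_right _ hs) _

variable [Fintype U]

lemma card_pebblingFormula_le (ι : U × Bool → X) (P : U → Finset U) (t : U) {m : ℕ}
    (hm : ∀ v, (P v).card ≤ m) :
    (pebblingFormula ι P t).card ≤ Fintype.card U * 2 ^ (2 * (m + 1)) + 4 := by
  refine (Finset.card_union_le _ _).trans (Nat.add_le_add ?_ ?_)
  · refine Finset.card_biUnion_le_card_mul _ _ _ fun v _ => ?_
    refine (card_image_forbid_le _ _).trans (Nat.pow_le_pow_right (by norm_num) ?_)
    have h1 := card_vars_le ι (insert v (P v))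
    have h2 := Finset.card_insert_le v (P v)
    have h3 := hm v
    omega
  · refine (card_image_forbid_le _ _).trans ?_
    have := card_vars_le ι {t}
    rw [Finset.card_singleton] at this
    exact (Nat.pow_le_pow_right (by norm_num) this).trans (by norm_num)

/-- The pebbling formula has a resolution refutation of length linear in the number of vertices. -/
theorem exists_isResRefutation (ι : U × Bool → X) (P : U → Finset U) (t : U) {m : ℕ}
    (hm : ∀ v, (P v).card ≤ m)
    (hP : ∀ D : Finset U, (∀ v, P v ⊆ D → v ∈ D) → D = Finset.univ) :
    ∃ π, IsResRefutation (pebblingFormula ι P t).val π ∧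
      π.length ≤ (pebblingFormula ι P t).card + Fintype.card U * (4 * 2 ^ (2 * m)) + 4 := by
  classical
  let F := pebblingFormula ι P t
  have hstart : IsDerivation F.val F.toList :=
    isDerivation_of_subset _ fun C hC => by simpa using hC
  have hstep : ∀ r ≤ Fintype.card U, ∃ π, IsDerivation F.val π ∧ F.toList ⊆ π ∧
      π.length ≤ F.card + r * (4 * 2 ^ (2 * m)) ∧
      r ≤ (Finset.univ.filter (Derives ι π)).card := by
    intro r
    induction r with
    | zero => exact fun _ => ⟨F.toList, hstart, fun _ => id, by simp, by simp⟩
    | succ r ih =>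
      intro hr
      obtain ⟨π, h1, h2, h3, h4⟩ := ih (by omega)
      by_cases hfull : Finset.univ.filter (Derives ι π) = Finset.univ
      · refine ⟨π, h1, h2, h3.trans ?_, by rw [hfull]; simpa using hr⟩
        exact Nat.add_le_add_left (Nat.mul_le_mul_right _ (Nat.le_succ r)) _
      -- Were there no such vertex, the derived set would be closed, hence full by `hP`.
      · obtain ⟨v, hPv, hv⟩ : ∃ v, P v ⊆ Finset.univ.filter (Derives ι π) ∧
            v ∉ Finset.univ.filter (Derives ι π) := by
          by_contra! hno
          exact hfull (hP _ hno)
        obtain ⟨π', h5, h6, h7, h8⟩ := h1.exists_derives v (hm v) (fun C hC => h2 (by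
          simp only [Finset.mem_toList, F, pebblingFormula]
          exact Finset.mem_union_left _ (Finset.mem_biUnion.2 ⟨v, Finset.mem_univ v, hC⟩)))
          fun u hu => (Finset.mem_filter.1 (hPv hu)).2
        refine ⟨π', h5, fun C hC => h6 (h2 hC), ?_, ?_⟩
        · rw [add_mul]
          omega
        · have h9 : insert v (Finset.univ.filter (Derives ι π)) ⊆
              Finset.univ.filter (Derives ι π') := by
            refine Finset.insert_subset (by simpa using h8) fun u hu => ?_
            have : Derives ι π u := (Finset.mem_filter.1 hu).2
            simpa using this.mono h6
          have h10 := Finset.card_le_card h9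
          rw [Finset.card_insert_of_notMem hv] at h10
          omega
  obtain ⟨π, h1, h2, h3, h4⟩ := hstep _ le_rfl
  have hall : Finset.univ.filter (Derives ι π) = Finset.univ :=
    Finset.eq_univ_of_card _ ((Finset.card_le_univ _).antisymm h4)
  have ht : Derives ι π t := by
    have := hall ▸ Finset.mem_univ t
    exact (Finset.mem_filter.1 this).2
  obtain ⟨π', h5, -, h7, C, hC, hCs⟩ := IsDerivation.exists_subset_forbid (vars ι {t}) ∅
    (fun _ => false) π h1 (by
      intro γ _
      rw [Finset.empty_union]
      cases hγ : value ι γ t with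
      | false => exact ht γ hγ
      | true =>
        refine ⟨_, h2 ?_, subset_rfl⟩
        simp only [Finset.mem_toList, F, pebblingFormula]
        exact Finset.mem_union_right _ (mem_sinkClauses.2 ⟨γ, hγ, rfl⟩))
  refine ⟨π', ⟨h5, ?_⟩, ?_⟩
  · rwa [show C = ∅ by simpa [forbid] using hCs] at hC
  · have h8 := card_vars_le ι {t}
    rw [Finset.card_singleton] at h8
    have hF : F.card = (pebblingFormula ι P t).card := rfl
    have h9 : 2 ^ (vars ι {t}).card ≤ 2 ^ 2 := Nat.pow_le_pow_right (by norm_num) (by omega)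
    omega

end UpperBound

/-! ### Assembly and asymptotics -/

lemma Reachable.map_val {W : Type} [DecidableEq W] {V : Finset W} {P : W → Finset W}
    (hP : ∀ v ∈ V, P v ⊆ V) {d : ℕ} {S : Finset V}
    (h : Reachable (fun v : V => Finset.univ.filter fun u : V => (u : W) ∈ P v) d S) :
    Reachable P d (S.map (Function.Embedding.subtype _)) := by
  have hsub : ∀ {S : Finset V} {v : V},
      (Finset.univ.filter fun u : V => (u : W) ∈ P v) ⊆ S →
        P v ⊆ S.map (Function.Embedding.subtype _) := by
    intro S v h u hu
    have huV := hP v v.2 hu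
    exact Finset.mem_map.2 ⟨⟨u, huV⟩, h (by simpa using hu), rfl⟩
  induction h with
  | empty => exact Reachable.empty
  | @place S v _ hv hPS hcard ih =>
    rw [Finset.map_insert]
    refine ih.place (by simpa using hv) (hsub hPS) ?_
    have := Finset.map_insert (Function.Embedding.subtype _) v S
    rw [← this, Finset.card_map]
    exact hcard
  | @remove S v _ hv hPS ih =>
    rw [Finset.map_insert] at ih
    exact ih.remove (by simpa using hv) (hsub hPS)

/-- Formulas over `n` variables with short resolution refutations, all of whose odd hitting
refutations are of size exponential in `2 ^ k`, where `n` is at least of the order of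
`2 ^ k * k`. -/
theorem exists_formula : ∃ m : ℕ, ∀ k n : ℕ, 32 * (2 ^ k * (k + 1)) ≤ n →
    ∃ F : CNF (Fin n), F.card ≤ n * 2 ^ m + 4 ∧
      (∃ π, IsResRefutation F π ∧ π.length ≤ n * 2 ^ m + 4 + n * 2 ^ m + 4) ∧
      ∀ H, IsOddHittingRefutation F H → 4 ^ 2 ^ k ≤ H.card * 3 ^ 2 ^ k := by
  classical
  obtain ⟨E, hE⟩ := exists_isExpanderFamily
  -- Only uniformity in `k` matters; an opaque `r` keeps the powers of 2 symbolic.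
  obtain ⟨r, hr⟩ : ∃ r, ∀ k v, (preds k E v).card ≤ r := ⟨168, fun _ v => card_preds hE v⟩
  refine ⟨2 * (r + 1), fun k n hn => ?_⟩
  have hpos : 0 < 2 ^ k := by positivity
  obtain ⟨t, ht, hunreach⟩ := (flow_block hE k [] (by simp) subset_rfl).exists_unreachable
    (d := 2 ^ k - 1) (by rw [card_layer]; omega) (by omega)
  let V := block k []
  let P : V → Finset V := fun v => Finset.univ.filter fun u : V => (u : Vertex) ∈ preds k E v
  let t' : V := ⟨t, layer_subset_block k [] true ht⟩
  have hV : Fintype.card V * 2 ≤ n := by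
    have := card_block k []
    rw [Fintype.card_coe]
    simp only [V]
    omega
  -- Variables outside the range of `ι` do not occur in the formula.
  obtain ⟨ι⟩ : Nonempty (V × Bool ↪ Fin n) :=
    Function.Embedding.nonempty_of_card_le (by simpa using hV)
  have hPr : ∀ v, (P v).card ≤ r := by
    intro v
    refine le_trans ?_ (hr k v)
    rw [← Finset.card_map (Function.Embedding.subtype _)]
    refine Finset.card_le_card fun u hu => ?_
    obtain ⟨w, hw, rfl⟩ := Finset.mem_map.1 hu
    exact (Finset.mem_filter.1 hw).2
  have hclosed : ∀ D : Finset V, (∀ v, P v ⊆ D → v ∈ D) → D = Finset.univ := by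
    intro D hD
    have h := block_subset_of_closed (k := k) (E := E)
      (D := D.map (Function.Embedding.subtype _)) (fun v hv hsub => by
        refine Finset.mem_map.2 ⟨⟨v, hv⟩, hD _ fun u hu => ?_, rfl⟩
        obtain ⟨w, hw, hwu⟩ := Finset.mem_map.1 (hsub (Finset.mem_filter.1 hu).2)
        rwa [← Subtype.ext (a1 := w) (a2 := u) hwu])
    refine Finset.eq_univ_of_forall fun v => ?_
    obtain ⟨w, hw, hwv⟩ := Finset.mem_map.1 (h v.2)
    rwa [← Subtype.ext (a1 := w) (a2 := v) hwv]
  have hcard := card_pebblingFormula_le ι P t' hPr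
  obtain ⟨π, hπ, hlen⟩ := exists_isResRefutation ι P t' hPr hclosed
  have h1 : Fintype.card V * 2 ^ (2 * (r + 1)) ≤ n * 2 ^ (2 * (r + 1)) :=
    Nat.mul_le_mul_right _ (by omega)
  have h2 : 4 * 2 ^ (2 * r) = 2 ^ (2 * (r + 1)) := by rw [mul_add, pow_add]; ring
  rw [h2] at hlen
  refine ⟨(pebblingFormula ι P t').val, by rw [Finset.card_val]; omega, ⟨π, hπ, by omega⟩, ?_⟩
  intro H hH
  have := pow_le_card_mul_pow ι.injective (d := 2 ^ k - 1) (fun S hS hmem => ?_) hH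
  · rwa [Nat.sub_add_cancel hpos] at this
  · refine hunreach _ (hS.map_val fun v _ u hu => (mem_preds.1 hu).1) ?_
    exact Finset.mem_map.2 ⟨t', hmem, rfl⟩

lemma exists_height {n : ℕ} (hn : 32 ≤ n) :
    ∃ k, 32 * (2 ^ k * (k + 1)) ≤ n ∧ n < 64 * (2 ^ k * (k + 2)) := by
  have hex : ∃ k, n < 32 * (2 ^ k * (k + 1)) := by
    refine ⟨n, ?_⟩
    have : n + 1 ≤ 2 ^ n * (n + 1) := Nat.le_mul_of_pos_left _ (by positivity)
    omega
  have h1 := Nat.find_spec hex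
  have h2 := fun k hk => Nat.find_min hex (m := k) hk
  rcases hk : Nat.find hex with _ | k
  · rw [hk] at h1
    simp at h1
    omega
  · rw [hk] at h1 h2
    refine ⟨k, not_lt.1 (h2 k (Nat.lt_succ_self k)), h1.trans_le (le_of_eq ?_)⟩
    rw [pow_succ]
    ring

/-- From `n ≥ 2 ^ (k + 5)` follows `log n ≥ (k + 2) / 2`, so `n / log n ≤ 128 * 2 ^ k`. With `2 ≤ (4
/ 3) ^ 3` this explains `384 = 3 * 128`. -/
lemma rpow_div_log_le {n k m : ℕ} (hn : 32 * (2 ^ k * (k + 1)) ≤ n)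
    (hn' : n < 64 * (2 ^ k * (k + 2))) (hm : 4 ^ 2 ^ k ≤ m * 3 ^ 2 ^ k) :
    (2 : ℝ) ^ ((1 / 384 : ℝ) * ((n : ℝ) / Real.log n)) ≤ m := by
  set q := 2 ^ k with hq
  have hlog : ((k : ℝ) + 2) / 2 ≤ Real.log n := by
    have h1 : 2 ^ (k + 5) ≤ n := by
      refine le_trans ?_ hn
      rw [pow_add, ← hq]
      nlinarith [Nat.zero_le (q * k)]
    have h2 : Real.log ((2 : ℝ) ^ (k + 5)) ≤ Real.log n :=
      Real.log_le_log (by positivity) (by exact_mod_cast h1)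
    rw [Real.log_pow] at h2
    have h3 := Real.log_two_gt_d9
    push_cast at h2
    nlinarith [(Nat.cast_nonneg k : (0 : ℝ) ≤ k)]
  have hlogpos : 0 < Real.log n := lt_of_lt_of_le (by positivity) hlog
  have hexp : (1 / 384 : ℝ) * ((n : ℝ) / Real.log n) ≤ (q : ℝ) / 3 := by
    have h1 : (n : ℝ) ≤ 64 * (q * (k + 2)) := by exact_mod_cast hn'.le
    have h2 : (n : ℝ) / Real.log n ≤ 128 * q := by
      rw [div_le_iff₀ hlogpos]
      nlinarith [mul_le_mul_of_nonneg_left hlog (Nat.cast_nonneg q : (0 : ℝ) ≤ q)]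
    linarith
  calc (2 : ℝ) ^ ((1 / 384 : ℝ) * ((n : ℝ) / Real.log n)) ≤ (2 : ℝ) ^ ((q : ℝ) / 3) :=
        Real.rpow_le_rpow_of_exponent_le (by norm_num) hexp
    _ ≤ ((4 / 3 : ℝ) ^ (3 : ℝ)) ^ ((q : ℝ) / 3) :=
        Real.rpow_le_rpow (by norm_num) (by norm_num) (by positivity)
    _ = (4 / 3 : ℝ) ^ q := by
        rw [← Real.rpow_mul (by norm_num), mul_div_cancel₀ _ (by norm_num), Real.rpow_natCast]
    _ ≤ m := by
        rw [div_pow, div_le_iff₀ (by positivity)]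
        exact_mod_cast hm

end OddHit

theorem mainTheorem10 :
    ∃ F : (n : ℕ) → OddHit.CNF (Fin n),
      (∃ k : ℕ, ∀ n : ℕ,
        (F n).card ≤ n ^ k + k ∧
        ∃ π : List (OddHit.Clause (Fin n)),
          OddHit.IsResRefutation (F n) π ∧ π.length ≤ n ^ k + k) ∧
      (∃ c : ℝ, 0 < c ∧ ∃ N : ℕ, ∀ n : ℕ, N ≤ n →
        ∀ H : OddHit.CNF (Fin n), OddHit.IsOddHittingRefutation (F n) H →
          (2 : ℝ) ^ (c * ((n : ℝ) / Real.log (n : ℝ))) ≤ (H.card : ℝ)) := by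
  obtain ⟨m, hm⟩ := OddHit.exists_formula
  have hF : ∀ n : ℕ, ∃ F : OddHit.CNF (Fin n),
      (F.card ≤ n ^ (m + 10) + (m + 10) ∧
        ∃ π : List (OddHit.Clause (Fin n)),
          OddHit.IsResRefutation F π ∧ π.length ≤ n ^ (m + 10) + (m + 10)) ∧
      (32 ≤ n → ∀ H : OddHit.CNF (Fin n), OddHit.IsOddHittingRefutation F H →
          (2 : ℝ) ^ ((1 / 384 : ℝ) * ((n : ℝ) / Real.log (n : ℝ))) ≤ (H.card : ℝ)) := by
    intro n
    rcases lt_or_ge n 32 with hn | hn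
    -- For small `n` no lower bound is claimed, and the formula with only the empty clause serves.
    · refine ⟨{∅}, ⟨by simp; omega, [∅], ⟨fun i => Or.inl ?_, by simp⟩, by simp; omega⟩,
        fun h => absurd hn h.not_gt⟩
      simp
    · obtain ⟨k, hk, hk'⟩ := OddHit.exists_height hn
      obtain ⟨F, h1, ⟨π, h2, h3⟩, h4⟩ := hm k n hk
      have hpow : n * 2 ^ m + n * 2 ^ m ≤ n ^ (m + 10) := by
        calc n * 2 ^ m + n * 2 ^ m = 2 ^ m * (n * 2) := by ring
          _ ≤ n ^ m * (n * n) := by gcongr <;> omega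
          _ = n ^ (m + 2) := by ring
          _ ≤ n ^ (m + 10) := Nat.pow_le_pow_right (by omega) (by omega)
      exact ⟨F, ⟨by omega, π, h2, by omega⟩, fun _ H hH =>
        OddHit.rpow_div_log_le hk hk' (h4 H hH)⟩
  choose F hF1 hF2 using hF
  exact ⟨F, ⟨m + 10, hF1⟩, 1 / 384, by norm_num, 32, hF2⟩
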